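/- Let $q$ and $t$ be indeterminates. For $k\ge 1$ let $W_k(q,t)$ be the directed multigraph with a hub $v_0$ and rim vertices $v_1,\dots,v_k$ (indices modulo $k$), with $q$ edges from $v_i$ to $v_{i+1}$, one edge from $v_i$ to $v_{i-1}$, and $t$ edges in each direction between $v_0$ and every $v_i$ (multiplicities add up when $k=2$; the rim edges are loops when $k=1$). Let $\mathcal W_k(q,t)\in\mathbb Z[q,t]$ be the polynomial that counts its spanning trees directed towards $v_0$. Let $N_k(q,N_1)=1+q^k-\alpha^k-\beta^k\in\mathbb Z[q,N_1]$, where $\alpha+\beta=1+q-N_1$ and $\alpha\beta=q$, be the polynomial expressing the number of $\mathbb F_{q^k}$-points of an elliptic curve over $\mathbb F_q$ with $N_1$ $\mathbb F_q$-points. The elliptic cyclotomic polynomials $ECyc_d\in\mathbb Z[q,N_1]$ are determined by $N_k=\prod_{d\mid k}ECyc_d$ for all $k\ge1$. Put $WCyc_1=t$ and $WCyc_d(q,t)=ECyc_d(q,-t)$ for $d\ge 2$. Now let $q\ge 0$ and $t\ge 1$ be integers. Let $K(W_k(q,t))$ be the critical group of $W_k(q,t)$ with bank $v_0$: its elements are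 the critical (that is, stable and recurrent) configurations $[c_1,\dots,c_k]$ of the dollar game, in which a rim vertex fires when it has at least $1+q+t$ chips and the bank fires only when no rim vertex can; the sum of two elements is the unique critical configuration reachable from their pointwise sum. For $k\mid l$, the periodic extension $w\mapsto ww\cdots w$ embeds $K(W_k(q,t))$ into $K(W_l(q,t))$. Let $K(\overline W(q,t))$ be the direct limit of these groups over the positive integers ordered by divisibility, and let $\rho$ be the shift map on it, induced by the rotations $[c_1,\dots,c_k]\mapsto[c_2,\dots,c_k,c_1]$. **Theorem.** The factorizations $N_k=\prod_{d\mid k}ECyc_d$ and $\mathcal W_k=\prod_{d\mid k}WCyc_d$ hold for all $k\ge 1$ (so such polynomials exist), and for all integers $d\ge1$, $q\ge0$, $t\ge1$, with $Cyc_d$ the $d$-th cyclotomic polynomial, the kernel of $Cyc_d(\rho)\colon K(\overline W(q,t))\to K(\overline W(q,t))$ is finite and $$WCyc_d(q,t)=\bigl|\ker Cyc_d(\rho)\bigr|.$$ -/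

import Mathlib

open scoped BigOperators

/-! ### Rooted directed multigraphs and chip firing

A directed multigraph with vertex set `Option V` is given by its edge multiplicities `d v w`.
The vertex `none` is the root (also called the bank or the hub). -/

/-- The out-degree of a vertex. A loop, where there is one, counts as an outgoing edge. -/
def outDegree {V : Type*} [Fintype V] (d : Option V → Option V → ℕ) (v : Option V) : ℕ :=
  ∑ w, d v w

/-- A configuration records the number of chips on every vertex other than the bank; the bank
holds minus the total of the others. It is stable if no vertex other than the bank can fire. -/
def IsStable {V : Type*} [Fintype V] (d : Option V → Option V → ℕ) (c : V → ℕ) : Prop :=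
  ∀ v, c v < outDegree d (some v)

/-- One legal firing in the dollar game. A vertex `v` other than the bank may fire if it holds at
least as many chips as its out-degree: one chip then moves along every edge that leaves `v`.
The bank may fire only if no other vertex can. -/
inductive Fires {V : Type*} [Fintype V] [DecidableEq V] (d : Option V → Option V → ℕ) :
    (V → ℕ) → (V → ℕ) → Prop
  | vertex (c c' : V → ℕ) (v : V) (h : outDegree d (some v) ≤ c v)
      (h' : ∀ w, c' w + (if w = v then outDegree d (some v) else 0) = c w + d (some v) (some w)) :
      Fires d c c'
  | bank (c c' : V → ℕ) (h : IsStable d c) (h' : ∀ w, c' w = c w + d none (some w)) :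
      Fires d c c'

/-- Critical configurations: stable, and recurrent (a nonempty firing sequence leads back). -/
def IsCritical {V : Type*} [Fintype V] [DecidableEq V] (d : Option V → Option V → ℕ)
    (c : V → ℕ) : Prop :=
  IsStable d c ∧ Relation.TransGen (Fires d) c c

/-- A spanning tree directed towards the root `none` is given by choosing for every other vertex `v`
one outgoing edge, to `p v`, such that following the chosen edges always leads to the root. -/
def IsRootedTree {V : Type*} (p : V → Option V) : Prop :=
  ∀ v, ∃ n : ℕ, (fun o : Option V => o.bind p)^[n] (some v) = none

open Classical in
/-- The number of directed spanning trees rooted at `none`, where `d v w` is the number of edges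
from `v` to `w`, possibly as a polynomial in some parameters. -/
noncomputable def treeCount {V R : Type*} [Fintype V] [CommSemiring R]
    (d : Option V → Option V → R) : R :=
  ∑ p : V → Option V with IsRootedTree p, ∏ v, d (some v) (p v)

/-! ### The wheel graphs -/

/-- Edge multiplicities of the `(q,t)`-wheel: the hub is `none`, the rim vertices are labelled
clockwise by `ZMod k`. There are `q` edges from `i` to `i + 1`, one edge from `i` to `i - 1`, and
`t` edges in both directions between the hub and every rim vertex. Multiplicities add up
where `i + 1 = i - 1`, and these edges are loops where `k = 1`. -/
def wheel {R : Type*} [CommSemiring R] (q t : R) (k : ℕ) : Option (ZMod k) → Option (ZMod k) → R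
  | some i, some j => (if j = i + 1 then q else 0) + (if j = i - 1 then 1 else 0)
  | some _, none => t
  | none, some _ => t
  | none, none => 0

/-- The underlying set of the critical group of the `(q,t)`-wheel with `k` rim vertices:
its critical configurations. -/
@[ext]
structure WheelGroup (q t k : ℕ) [NeZero k] : Type where
  /-- The configuration. -/
  config : ZMod k → ℕ
  /-- It is critical. -/
  critical : IsCritical (wheel q t k) config

section helpers

/-- The reduced Laplacian of the wheel, acting on counts of firings. -/
def wheelLap (q t k : ℕ) : (ZMod k → ℤ) →+ (ZMod k → ℤ) where
  toFun x := fun i => (1 + q + t) * x i - q * x (i - 1) - x (i + 1)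
  map_zero' := by ext; simp
  map_add' x y := by ext; simp; ring

/-- Two configurations differ by an integer combination of firings. -/
def WheelEquiv {q t k : ℕ} (c c' : ZMod k → ℕ) : Prop :=
  ∃ x : ZMod k → ℤ, ∀ i, (c i : ℤ) = c' i + wheelLap q t k x i

theorem WheelEquiv.refl {q t k : ℕ} (c : ZMod k → ℕ) : WheelEquiv (q := q) (t := t) c c :=
  ⟨0, by simp⟩

theorem WheelEquiv.symm {q t k : ℕ} {c c' : ZMod k → ℕ} (h : WheelEquiv (q := q) (t := t) c c') :
    WheelEquiv (q := q) (t := t) c' c := by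
  obtain ⟨x, hx⟩ := h
  exact ⟨-x, fun i => by rw [map_neg, Pi.neg_apply, hx]; ring⟩

theorem WheelEquiv.trans {q t k : ℕ} {a b c : ZMod k → ℕ} (h : WheelEquiv (q := q) (t := t) a b)
    (h' : WheelEquiv (q := q) (t := t) b c) : WheelEquiv (q := q) (t := t) a c := by
  obtain ⟨x, hx⟩ := h
  obtain ⟨y, hy⟩ := h'
  exact ⟨x + y, fun i => by rw [map_add, Pi.add_apply, hx, hy]; ring⟩

theorem WheelEquiv.add {q t k : ℕ} {a b c d : ZMod k → ℕ} (h : WheelEquiv (q := q) (t := t) a b)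
    (h' : WheelEquiv (q := q) (t := t) c d) : WheelEquiv (q := q) (t := t) (a + c) (b + d) := by
  obtain ⟨x, hx⟩ := h
  obtain ⟨y, hy⟩ := h'
  refine ⟨x + y, fun i => ?_⟩
  rw [map_add, Pi.add_apply, Pi.add_apply, Pi.add_apply]
  push_cast
  rw [hx, hy]; ring

theorem outDegree_wheel (q t k : ℕ) [NeZero k] (i : ZMod k) :
    outDegree (wheel q t k) (some i) = 1 + q + t := by
  simp [outDegree, wheel, Fintype.sum_option, Finset.sum_add_distrib]
  ring

theorem wheelLap_single (q t k : ℕ) (i j : ZMod k) :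
    wheelLap q t k (Pi.single i 1) j =
      (if j = i then (1 + q + t : ℤ) else 0) - (wheel q t k (some i) (some j) : ℕ) := by
  have h1 : (j - 1 = i) = (j = i + 1) := by rw [sub_eq_iff_eq_add]
  have h2 : (j + 1 = i) = (j = i - 1) := by rw [eq_sub_iff_add_eq]
  simp only [wheelLap, AddMonoidHom.coe_mk, ZeroHom.coe_mk, Pi.single_apply, wheel, h1, h2]
  split_ifs <;> push_cast <;> ring

theorem wheelLap_const (q t k : ℕ) (n : ℤ) (j : ZMod k) :
    wheelLap q t k (fun _ => n) j = t * n := by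
  simp only [wheelLap, AddMonoidHom.coe_mk, ZeroHom.coe_mk]
  ring

/-- A legal firing, in integers: a rim vertex fires, or the bank does. -/
theorem fires_wheel {q t k : ℕ} [NeZero k] {c c' : ZMod k → ℕ} :
    Fires (wheel q t k) c c' ↔
      (∃ i, 1 + q + t ≤ c i ∧ ∀ j, (c' j : ℤ) = c j - wheelLap q t k (Pi.single i 1) j) ∨
      (IsStable (wheel q t k) c ∧ ∀ j, c' j = c j + t) := by
  constructor
  · rintro (⟨i, h, h'⟩ | ⟨h, h'⟩)
    · left
      rw [outDegree_wheel] at h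
      refine ⟨i, h, fun j => ?_⟩
      have := h' j
      rw [outDegree_wheel] at this
      rw [wheelLap_single]
      split_ifs at * <;> linarith
    · exact Or.inr ⟨h, h'⟩
  · rintro (⟨i, h, h'⟩ | ⟨h, h'⟩)
    · refine Fires.vertex c c' i (by rwa [outDegree_wheel]) fun j => ?_
      have := h' j
      rw [outDegree_wheel]
      rw [wheelLap_single] at this
      zify
      split_ifs at * <;> linarith
    · exact Fires.bank c c' h h'

theorem wheelEquiv_of_fires {q t k : ℕ} [NeZero k] {c c' : ZMod k → ℕ}
    (h : Fires (wheel q t k) c c') : WheelEquiv (q := q) (t := t) c c' := by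
  rcases fires_wheel.1 h with ⟨i, -, h'⟩ | ⟨-, h'⟩
  · exact ⟨Pi.single i 1, fun j => by rw [h']; ring⟩
  · exact ⟨fun _ => -1, fun j => by rw [wheelLap_const, h']; push_cast; ring⟩

theorem wheelEquiv_of_reflTransGen {q t k : ℕ} [NeZero k] {c c' : ZMod k → ℕ}
    (h : Relation.ReflTransGen (Fires (wheel q t k)) c c') :
    WheelEquiv (q := q) (t := t) c c' := by
  induction h with
  | refl => exact .refl _
  | tail _ h ih => exact ih.trans (wheelEquiv_of_fires h)

theorem sum_wheelLap (q t k : ℕ) [NeZero k] (x : ZMod k → ℤ) :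
    ∑ i, wheelLap q t k x i = t * ∑ i, x i := by
  simp only [wheelLap, AddMonoidHom.coe_mk, ZeroHom.coe_mk, Finset.sum_sub_distrib,
    ← Finset.mul_sum]
  have h1 : ∑ i, x (i - 1) = ∑ i, x i :=
    Equiv.sum_comp (Equiv.subRight (1 : ZMod k)) x
  have h2 : ∑ i, x (i + 1) = ∑ i, x i :=
    Equiv.sum_comp (Equiv.addRight (1 : ZMod k)) x
  rw [h1, h2]
  ring

/-- Every configuration can be stabilized. -/
theorem exists_stable (q t k : ℕ) [NeZero k] [NeZero t] (c : ZMod k → ℕ) :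
    ∃ s, Relation.ReflTransGen (Fires (wheel q t k)) c s ∧ IsStable (wheel q t k) s := by
  induction h : ∑ i, c i using Nat.strong_induction_on generalizing c with
  | _ n ih =>
    by_cases hs : IsStable (wheel q t k) c
    · exact ⟨c, .refl, hs⟩
    · simp only [IsStable, not_forall, not_lt, outDegree_wheel] at hs
      obtain ⟨i, hi⟩ := hs
      let c' : ZMod k → ℕ := fun j => ((c j : ℤ) - wheelLap q t k (Pi.single i 1) j).toNat
      have hc' : ∀ j, (c' j : ℤ) = c j - wheelLap q t k (Pi.single i 1) j := by
        intro j
        refine Int.toNat_of_nonneg ?_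
        rw [wheelLap_single]
        split_ifs with hj
        · subst hj; omega
        · omega
      have hf : Fires (wheel q t k) c c' := fires_wheel.2 (.inl ⟨i, hi, hc'⟩)
      have hlt : ∑ j, c' j < n := by
        have : (∑ j, (c' j : ℤ)) = ∑ j, (c j : ℤ) - t := by
          simp only [hc', Finset.sum_sub_distrib]
          rw [sum_wheelLap]; simp
        have ht : 0 < t := Nat.pos_of_ne_zero (NeZero.ne t)
        zify
        rw [this, ← h]; push_cast; omega
      obtain ⟨s, h1, h2⟩ := ih _ hlt c' rfl
      exact ⟨s, .head hf h1, h2⟩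

/-- A critical configuration can be reached from every configuration. -/
theorem exists_critical (q t k : ℕ) [NeZero k] [NeZero t] (c : ZMod k → ℕ) :
    ∃ s, Relation.ReflTransGen (Fires (wheel q t k)) c s ∧ IsCritical (wheel q t k) s := by
  let S := {s : ZMod k → ℕ // IsStable (wheel q t k) s}
  have key : ∀ s : S, ∃ s' : S, Relation.TransGen (Fires (wheel q t k)) s.1 s'.1 := by
    intro s
    obtain ⟨s', h1, h2⟩ := exists_stable q t k (fun j => s.1 j + t)
    exact ⟨⟨s', h2⟩, .head' (fires_wheel.2 (.inr ⟨s.2, fun _ => rfl⟩)) h1⟩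
  choose f hf using key
  obtain ⟨s₀, h1, h2⟩ := exists_stable q t k c
  have hfin : Finite S := by
    refine Set.Finite.to_subtype
      ((Set.Finite.pi' (fun _ : ZMod k => Set.finite_Iio (1 + q + t))).subset ?_)
    intro s hs i
    have := hs i
    rwa [outDegree_wheel] at this
  have hpath : ∀ (n : ℕ) (s : S),
      Relation.ReflTransGen (Fires (wheel q t k)) s.1 (f^[n] s).1 := by
    intro n
    induction n with
    | zero => intro s; exact .refl
    | succ n ih => intro s; exact (hf s).to_reflTransGen.trans (ih (f s))
  obtain ⟨m, n, hmn, he⟩ : ∃ m n : ℕ, m < n ∧ f^[m] ⟨s₀, h2⟩ = f^[n] ⟨s₀, h2⟩ := by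
    obtain ⟨m, n, hne, he⟩ := Finite.exists_ne_map_eq_of_infinite (fun n : ℕ => f^[n] ⟨s₀, h2⟩)
    rcases lt_or_gt_of_ne hne with h | h
    · exact ⟨m, n, h, he⟩
    · exact ⟨n, m, h, he.symm⟩
  refine ⟨(f^[m] ⟨s₀, h2⟩).1, h1.trans (hpath m ⟨s₀, h2⟩), (f^[m] ⟨s₀, h2⟩).2, ?_⟩
  obtain ⟨l, rfl⟩ := Nat.exists_eq_add_of_lt hmn
  have e : f^[m + l + 1] ⟨s₀, h2⟩ = f^[l] (f (f^[m] ⟨s₀, h2⟩)) := by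
    rw [show m + l + 1 = l + (1 + m) by ring, Function.iterate_add_apply,
      Function.iterate_add_apply f 1 m, Function.iterate_one]
  have := (hf (f^[m] ⟨s₀, h2⟩)).trans_left (hpath l (f (f^[m] ⟨s₀, h2⟩)))
  rwa [← e, ← he] at this

/-- In a critical configuration, no nonempty set of rim vertices can resist the bank. -/
theorem IsCritical.exists_burn {q t k : ℕ} [NeZero k] [NeZero t] {c : ZMod k → ℕ}
    (hc : IsCritical (wheel q t k) c) (A : ZMod k → Prop) [DecidablePred A] (hA : ∃ i, A i) :
    ∃ i, A i ∧ (1 + q + t : ℤ) ≤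
      c i + t + q * (if A (i - 1) then 0 else 1) + (if A (i + 1) then 0 else 1) := by
  by_contra! hres
  let y : ZMod k → ℤ := fun j => if A j then 0 else 1
  have hyA : ∀ j, A j → y j = 0 := fun j hj => by simp [y, hj]
  have hyA' : ∀ j, ¬ A j → y j = 1 := fun j hj => by simp [y, hj]
  replace hres : ∀ i, A i → (c i : ℤ) + t + q * y (i - 1) + y (i + 1) < 1 + q + t := hres
  have hst : ∀ i, (c i : ℤ) < 1 + q + t := by
    intro i
    have := hc.1 i
    rw [outDegree_wheel] at this
    exact_mod_cast this
  -- invariant along firing sequences: the bank has fired M times, vertex i has fired x i times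
  have inv : ∀ c' : ZMod k → ℕ, Relation.TransGen (Fires (wheel q t k)) c c' →
      ∃ (M : ℤ) (x : ZMod k → ℤ), 0 ≤ M ∧ (∀ i, 0 ≤ x i) ∧ (∀ i, x i ≤ M) ∧
        (1 ≤ M) ∧ (∀ i, A i → x i ≤ M - 1) ∧
        ∀ i, (c' i : ℤ) = c i + t * M - wheelLap q t k x i := by
    have step : ∀ (c₁ c₂ : ZMod k → ℕ) (M : ℤ) (x : ZMod k → ℤ), 0 ≤ M → (∀ i, 0 ≤ x i) →
        (∀ i, x i ≤ M) → (1 ≤ M → ∀ i, A i → x i ≤ M - 1) →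
        (∀ i, (c₁ i : ℤ) = c i + t * M - wheelLap q t k x i) → Fires (wheel q t k) c₁ c₂ →
        ∃ (M : ℤ) (x : ZMod k → ℤ), 0 ≤ M ∧ (∀ i, 0 ≤ x i) ∧ (∀ i, x i ≤ M) ∧
        (1 ≤ M) ∧ (∀ i, A i → x i ≤ M - 1) ∧
        ∀ i, (c₂ i : ℤ) = c i + t * M - wheelLap q t k x i := by
      intro c₁ c₂ M x hM hx0 hxM hxA hc₁ hf
      rcases fires_wheel.1 hf with ⟨i, hi, hi'⟩ | ⟨-, hb⟩
      · have hq : (0 : ℤ) ≤ q := Int.natCast_nonneg q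
        have hval := hc₁ i
        simp only [wheelLap, AddMonoidHom.coe_mk, ZeroHom.coe_mk] at hval
        have hi2 : (1 + q + t : ℤ) ≤ c₁ i := by exact_mod_cast hi
        have hlt : x i < M := by
          by_contra hge
          have hxi : x i = M := le_antisymm (hxM i) (not_lt.1 hge)
          have := mul_le_mul_of_nonneg_left (hxM (i - 1)) hq
          have := hxM (i + 1)
          have := hst i
          rw [hxi] at hval
          nlinarith
        have hM1 : 1 ≤ M := by have := hx0 i; omega
        have hlt2 : A i → x i < M - 1 := by
          intro hAi
          by_contra hge
          have hxi : x i = M - 1 := le_antisymm (hxA hM1 i hAi) (not_lt.1 hge)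
          have hb : ∀ j, x j ≤ M - 1 + y j := by
            intro j
            by_cases hj : A j
            · rw [hyA j hj]; linarith [hxA hM1 j hj]
            · rw [hyA' j hj]; linarith [hxM j]
          have := mul_le_mul_of_nonneg_left (hb (i - 1)) hq
          have := hb (i + 1)
          have := hres i hAi
          rw [hxi] at hval
          nlinarith
        refine ⟨M, x + Pi.single i 1, hM, ?_, ?_, hM1, ?_, ?_⟩
        · intro j
          have := hx0 j
          rw [Pi.add_apply, Pi.single_apply]; split_ifs <;> omega
        · intro j
          have := hxM j
          rw [Pi.add_apply, Pi.single_apply]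
          split_ifs with h
          · subst h; omega
          · omega
        · intro j hj
          have := hxA hM1 j hj
          rw [Pi.add_apply, Pi.single_apply]
          split_ifs with h
          · subst h; have := hlt2 hj; omega
          · omega
        · intro j
          rw [hi', hc₁, map_add, Pi.add_apply]; ring
      · refine ⟨M + 1, x, by omega, hx0, fun i => by linarith [hxM i], by omega, ?_, ?_⟩
        · intro i _
          linarith [hxM i]
        · intro i
          rw [hb, Nat.cast_add, hc₁]; ring
    intro c' h
    induction h with
    | single h =>
      exact step c _ 0 0 le_rfl (by simp) (by simp) (by omega) (by simp) h
    | tail _ h ih =>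
      obtain ⟨M, x, h1, h2, h3, h4, h5, h6⟩ := ih
      exact step _ _ M x h1 h2 h3 (fun _ => h5) h6 h
  obtain ⟨M, x, h1, h2, h3, h4, h5, h6⟩ := inv c hc.2
  have hsum : ∑ i, (wheelLap q t k (fun _ => M) i - wheelLap q t k x i) = 0 := by
    refine Finset.sum_eq_zero fun i _ => ?_
    rw [wheelLap_const]; linarith [h6 i]
  rw [Finset.sum_sub_distrib, sum_wheelLap, sum_wheelLap, ← mul_sub,
    ← Finset.sum_sub_distrib] at hsum
  have ht : (t : ℤ) ≠ 0 := by exact_mod_cast NeZero.ne t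
  have hz := (mul_eq_zero.1 hsum).resolve_left ht
  obtain ⟨i, hi⟩ := hA
  have := (Finset.sum_eq_zero_iff_of_nonneg (fun j _ => by linarith [h3 j])).1 hz i
    (Finset.mem_univ i)
  linarith [h5 i hi]

theorem critical_le_of_equiv {q t k : ℕ} [NeZero k] [NeZero t] {c c' : ZMod k → ℕ}
    (h : IsStable (wheel q t k) c) (h' : IsCritical (wheel q t k) c') (x : ZMod k → ℤ)
    (hx : ∀ i, (c i : ℤ) = c' i + wheelLap q t k x i) : ∀ i, x i ≤ 0 := by
  obtain ⟨m, hm⟩ := Finite.exists_max x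
  suffices x m ≤ 0 from fun i => (hm i).trans this
  by_contra! hpos
  obtain ⟨i, hi, hb⟩ := h'.exists_burn (fun i => x i = x m) ⟨m, rfl⟩
  have hle : ∀ j, x j + (if x j = x m then 0 else 1) ≤ x m := by
    intro j
    have := hm j
    split_ifs <;> omega
  have h1 := hle (i - 1)
  have h2 := hle (i + 1)
  have h3 := h i
  rw [outDegree_wheel] at h3
  have h3' : (c i : ℤ) < 1 + q + t := by exact_mod_cast h3
  rw [hx] at h3'
  simp only [wheelLap, AddMonoidHom.coe_mk, ZeroHom.coe_mk] at h3'
  have hq : (0 : ℤ) ≤ q := Int.natCast_nonneg q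
  have ht : (0 : ℤ) ≤ t := Int.natCast_nonneg t
  have h4 := mul_le_mul_of_nonneg_left h1 hq
  have h5 : (t : ℤ) * 1 ≤ t * x m := mul_le_mul_of_nonneg_left hpos ht
  rw [hi] at h3'
  nlinarith

/-- There is only one critical configuration modulo firings. -/
theorem critical_unique {q t k : ℕ} [NeZero k] [NeZero t] {c c' : ZMod k → ℕ}
    (h : IsCritical (wheel q t k) c) (h' : IsCritical (wheel q t k) c')
    (he : WheelEquiv (q := q) (t := t) c c') : c = c' := by
  obtain ⟨x, hx⟩ := he
  have h1 := critical_le_of_equiv h.1 h' x hx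
  have h2 := critical_le_of_equiv h'.1 h (-x) (fun i => by
    rw [map_neg, Pi.neg_apply, hx]; ring)
  have : x = 0 := by
    ext i
    have := h1 i
    have := h2 i
    simp only [Pi.neg_apply, Pi.zero_apply] at *
    omega
  subst this
  ext i
  have := hx i
  simp only [map_zero, Pi.zero_apply, add_zero] at this
  exact_mod_cast this

end helpers

namespace WheelGroup

/-- The critical configuration that can be reached from `c` by legal firings. -/
noncomputable def reduce (q t k : ℕ) [NeZero k] [NeZero t] (c : ZMod k → ℕ) : WheelGroup q t k :=
  ⟨(exists_critical q t k c).choose, (exists_critical q t k c).choose_spec.2⟩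

section helpers

theorem reduce_spec (q t k : ℕ) [NeZero k] [NeZero t] (c : ZMod k → ℕ) :
    Relation.ReflTransGen (Fires (wheel q t k)) c (reduce q t k c).1 :=
  (exists_critical q t k c).choose_spec.1

theorem reduce_equiv {q t k : ℕ} [NeZero k] [NeZero t] (c : ZMod k → ℕ) :
    WheelEquiv (q := q) (t := t) c (reduce q t k c).1 :=
  wheelEquiv_of_reflTransGen (reduce_spec q t k c)

theorem ext_equiv {q t k : ℕ} [NeZero k] [NeZero t] {C D : WheelGroup q t k}
    (h : WheelEquiv (q := q) (t := t) C.1 D.1) : C = D :=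
  WheelGroup.ext (critical_unique C.2 D.2 h)

theorem eq_reduce {q t k : ℕ} [NeZero k] [NeZero t] {C : WheelGroup q t k} {c : ZMod k → ℕ}
    (h : WheelEquiv (q := q) (t := t) C.1 c) : C = reduce q t k c :=
  ext_equiv (h.trans (reduce_equiv c))

end helpers

/-- The group operation: add pointwise, then reduce to the critical configuration. -/
noncomputable instance (q t k : ℕ) [NeZero k] [NeZero t] : Add (WheelGroup q t k) :=
  ⟨fun C D => reduce q t k (C.1 + D.1)⟩

noncomputable instance (q t k : ℕ) [NeZero k] [NeZero t] : Zero (WheelGroup q t k) :=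
  ⟨reduce q t k 0⟩

noncomputable instance (q t k : ℕ) [NeZero k] [NeZero t] : Neg (WheelGroup q t k) :=
  ⟨fun C => reduce q t k fun i => t * (1 + q + t) - C.1 i⟩

section helpers

theorem add_equiv {q t k : ℕ} [NeZero k] [NeZero t] (C D : WheelGroup q t k) :
    WheelEquiv (q := q) (t := t) (C + D).1 (C.1 + D.1) :=
  (reduce_equiv _).symm

theorem zero_equiv (q t k : ℕ) [NeZero k] [NeZero t] :
    WheelEquiv (q := q) (t := t) (0 : WheelGroup q t k).1 0 :=
  (reduce_equiv _).symm

theorem neg_equiv {q t k : ℕ} [NeZero k] [NeZero t] (C : WheelGroup q t k) :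
    WheelEquiv (q := q) (t := t) (-C).1 (fun i => t * (1 + q + t) - C.1 i) :=
  (reduce_equiv _).symm

end helpers

/-- The critical group of the `(q,t)`-wheel with `k` rim vertices. -/
noncomputable instance (q t k : ℕ) [NeZero k] [NeZero t] : AddCommGroup (WheelGroup q t k) where
  add_assoc A B C := ext_equiv (by
    have h1 := (add_equiv (A + B) C).trans ((add_equiv A B).add (.refl C.1))
    have h2 := (add_equiv A (B + C)).trans (WheelEquiv.add (.refl A.1) (add_equiv B C))
    rw [← add_assoc] at h2
    exact h1.trans h2.symm)
  zero_add A := ext_equiv (by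
    have h := (add_equiv 0 A).trans ((zero_equiv q t k).add (.refl A.1))
    rwa [zero_add] at h)
  add_zero A := ext_equiv (by
    have h := (add_equiv A 0).trans (WheelEquiv.add (.refl A.1) (zero_equiv q t k))
    rwa [add_zero] at h)
  add_comm A B := ext_equiv (by
    have h := add_equiv B A
    rw [add_comm] at h
    exact (add_equiv A B).trans h.symm)
  neg_add_cancel A := ext_equiv (by
    refine ((add_equiv (-A) A).trans ((neg_equiv A).add (.refl A.1))).trans
      (WheelEquiv.trans ?_ (zero_equiv q t k).symm)
    refine ⟨fun _ => 1 + q + t, fun i => ?_⟩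
    have h1 : A.1 i < 1 + q + t := by have := A.2.1 i; rwa [outDegree_wheel] at this
    have h2 : A.1 i ≤ t * (1 + q + t) :=
      h1.le.trans (Nat.le_mul_of_pos_left _ (Nat.pos_of_ne_zero (NeZero.ne t)))
    rw [wheelLap_const, Pi.add_apply]
    rw [Nat.sub_add_cancel h2]
    simp)
  nsmul := nsmulRec
  zsmul := zsmulRec

end WheelGroup

section helpers

theorem isStable_comp {q t k l : ℕ} [NeZero k] [NeZero l] {c : ZMod k → ℕ}
    (h : IsStable (wheel q t k) c) (f : ZMod l → ZMod k) :
    IsStable (wheel q t l) (c ∘ f) := by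
  intro i
  have := h (f i)
  rwa [outDegree_wheel] at this ⊢

/-- Vertices that can all fire may fire one after the other. -/
theorem fires_finset {q t k : ℕ} [NeZero k] (S : Finset (ZMod k)) (c : ZMod k → ℕ)
    (h : ∀ i ∈ S, 1 + q + t ≤ c i) :
    ∃ c' : ZMod k → ℕ, Relation.ReflTransGen (Fires (wheel q t k)) c c' ∧
      (S.Nonempty → Relation.TransGen (Fires (wheel q t k)) c c') ∧
      (∀ i ∉ S, c i ≤ c' i) ∧
      ∀ j, (c' j : ℤ) = c j - wheelLap q t k (fun i => if i ∈ S then 1 else 0) j := by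
  induction S using Finset.induction_on with
  | empty =>
    refine ⟨c, .refl, by simp, by simp, fun j => ?_⟩
    have : (fun i : ZMod k => if i ∈ (∅ : Finset (ZMod k)) then (1 : ℤ) else 0) = 0 := by
      ext; simp
    rw [this]; simp
  | insert a S ha ih =>
    obtain ⟨c₁, h1, -, h3, h4⟩ := ih fun i hi => h i (Finset.mem_insert_of_mem hi)
    have hca : 1 + q + t ≤ c₁ a := (h a (Finset.mem_insert_self _ _)).trans (h3 a ha)
    let c' : ZMod k → ℕ := fun j => ((c₁ j : ℤ) - wheelLap q t k (Pi.single a 1) j).toNat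
    have hc' : ∀ j, (c' j : ℤ) = c₁ j - wheelLap q t k (Pi.single a 1) j := by
      intro j
      refine Int.toNat_of_nonneg ?_
      rw [wheelLap_single]
      split_ifs with hj
      · subst hj; omega
      · omega
    have hf : Fires (wheel q t k) c₁ c' := fires_wheel.2 (.inl ⟨a, hca, hc'⟩)
    refine ⟨c', h1.tail hf, fun _ => .tail' h1 hf, fun i hi => ?_, fun j => ?_⟩
    · have hia : i ≠ a := fun e => hi (e ▸ Finset.mem_insert_self _ _)
      have h5 := h3 i fun e => hi (Finset.mem_insert_of_mem e)
      have h6 := hc' i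
      rw [wheelLap_single, if_neg hia] at h6
      omega
    · have : (fun i : ZMod k => if i ∈ insert a S then (1 : ℤ) else 0) =
          (fun i => if i ∈ S then 1 else 0) + Pi.single a 1 := by
        ext i
        rw [Pi.add_apply, Pi.single_apply]
        by_cases hia : i = a
        · subst hia; simp [ha]
        · simp [hia]
      rw [this, hc', h4, map_add, Pi.add_apply]; ring

theorem wheelLap_comp_cast {q t k l : ℕ} (h : k ∣ l) (x : ZMod k → ℤ) (j : ZMod l) :
    wheelLap q t l (x ∘ ZMod.castHom h (ZMod k)) j =
      wheelLap q t k x (ZMod.castHom h (ZMod k) j) := by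
  simp only [wheelLap, AddMonoidHom.coe_mk, ZeroHom.coe_mk, Function.comp_apply, map_sub, map_add,
    map_one]

theorem fires_comp_cast {q t k l : ℕ} [NeZero k] [NeZero l] (h : k ∣ l) {c c' : ZMod k → ℕ}
    (hf : Fires (wheel q t k) c c') :
    Relation.TransGen (Fires (wheel q t l)) (c ∘ ZMod.castHom h (ZMod k))
      (c' ∘ ZMod.castHom h (ZMod k)) := by
  rcases fires_wheel.1 hf with ⟨i, hi, hi'⟩ | ⟨hs, hb⟩
  · obtain ⟨d, -, h2, -, h4⟩ := fires_finset (q := q) (t := t)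
      (Finset.univ.filter fun j : ZMod l => ZMod.castHom h (ZMod k) j = i)
      (c ∘ ZMod.castHom h (ZMod k)) (fun j hj => by
        rw [Finset.mem_filter] at hj
        rw [Function.comp_apply, hj.2]; exact hi)
    have hd : d = c' ∘ ZMod.castHom h (ZMod k) := by
      ext j
      have h5 := h4 j
      have : (fun j : ZMod l => if j ∈ Finset.univ.filter
          (fun j : ZMod l => ZMod.castHom h (ZMod k) j = i) then (1 : ℤ) else 0) =
          (Pi.single i 1 : ZMod k → ℤ) ∘ ZMod.castHom h (ZMod k) := by
        ext j
        simp only [Finset.mem_filter, Finset.mem_univ, true_and, Function.comp_apply,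
          Pi.single_apply]
      rw [this, wheelLap_comp_cast, Function.comp_apply, ← hi'] at h5
      exact_mod_cast h5
    rw [← hd]
    refine h2 ?_
    obtain ⟨j, hj⟩ := ZMod.castHom_surjective h i
    exact ⟨j, Finset.mem_filter.2 ⟨Finset.mem_univ j, hj⟩⟩
  · exact .single (fires_wheel.2 (.inr ⟨isStable_comp hs _, fun j => hb _⟩))

theorem isCritical_comp_cast {q t k l : ℕ} [NeZero k] [NeZero l] (h : k ∣ l) {c : ZMod k → ℕ}
    (hc : IsCritical (wheel q t k) c) :
    IsCritical (wheel q t l) (c ∘ ZMod.castHom h (ZMod k)) := by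
  refine ⟨isStable_comp hc.1 _, ?_⟩
  have key : ∀ c' : ZMod k → ℕ, Relation.TransGen (Fires (wheel q t k)) c c' →
      Relation.TransGen (Fires (wheel q t l)) (c ∘ ZMod.castHom h (ZMod k))
        (c' ∘ ZMod.castHom h (ZMod k)) := by
    intro c' hc'
    induction hc' with
    | single h' => exact fires_comp_cast h h'
    | tail _ h' ih => exact ih.trans (fires_comp_cast h h')
  exact key c hc.2

theorem WheelEquiv.comp_cast {q t k l : ℕ} (h : k ∣ l) {c c' : ZMod k → ℕ}
    (hc : WheelEquiv (q := q) (t := t) c c') :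
    WheelEquiv (q := q) (t := t) (c ∘ ZMod.castHom h (ZMod k))
      (c' ∘ ZMod.castHom h (ZMod k)) := by
  obtain ⟨x, hx⟩ := hc
  exact ⟨x ∘ ZMod.castHom h (ZMod k), fun i => by
    rw [wheelLap_comp_cast, Function.comp_apply, hx]; rfl⟩

theorem wheelLap_rotate {q t k : ℕ} (x : ZMod k → ℤ) (j : ZMod k) :
    wheelLap q t k (fun i => x (i + 1)) j = wheelLap q t k x (j + 1) := by
  simp only [wheelLap, AddMonoidHom.coe_mk, ZeroHom.coe_mk]
  rw [show j - 1 + 1 = j + 1 - 1 by ring]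

theorem WheelEquiv.rotate {q t k : ℕ} {c c' : ZMod k → ℕ}
    (hc : WheelEquiv (q := q) (t := t) c c') :
    WheelEquiv (q := q) (t := t) (fun i => c (i + 1)) (fun i => c' (i + 1)) := by
  obtain ⟨x, hx⟩ := hc
  exact ⟨fun i => x (i + 1), fun i => by rw [wheelLap_rotate, hx]⟩

theorem fires_rotate {q t k : ℕ} [NeZero k] {c c' : ZMod k → ℕ}
    (hf : Fires (wheel q t k) c c') :
    Fires (wheel q t k) (fun i => c (i + 1)) (fun i => c' (i + 1)) := by
  rcases fires_wheel.1 hf with ⟨i, hi, hi'⟩ | ⟨hs, hb⟩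
  · refine fires_wheel.2 (.inl ⟨i - 1, by simpa using hi, fun j => ?_⟩)
    have : (Pi.single (i - 1) 1 : ZMod k → ℤ) = fun j => (Pi.single i 1 : ZMod k → ℤ) (j + 1) := by
      ext j
      simp only [Pi.single_apply, eq_sub_iff_add_eq]
    rw [this, wheelLap_rotate, hi']
  · exact fires_wheel.2 (.inr ⟨isStable_comp hs (fun i => i + 1), fun j => hb _⟩)

theorem isCritical_rotate {q t k : ℕ} [NeZero k] {c : ZMod k → ℕ}
    (hc : IsCritical (wheel q t k) c) : IsCritical (wheel q t k) (fun i => c (i + 1)) :=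
  ⟨isStable_comp hc.1 (fun i => i + 1), hc.2.lift (fun c i => c (i + 1)) fun _ _ => fires_rotate⟩

end helpers

namespace WheelGroup

/-- Periodic extension: for `k ∣ l`, the word `w` of length `k` goes to the word `w w ⋯ w`
of length `l`. -/
def extend (q t : ℕ) {k l : ℕ} [NeZero k] [NeZero l] [NeZero t] (h : k ∣ l) :
    WheelGroup q t k →+ WheelGroup q t l where
  toFun C := ⟨C.1 ∘ ZMod.castHom h (ZMod k), isCritical_comp_cast h C.2⟩
  map_zero' := eq_reduce ((zero_equiv q t k).comp_cast h)
  map_add' C D := eq_reduce ((add_equiv C D).comp_cast h)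

/-- Rotation to the left: `[c₁, c₂, …, c_k]` goes to `[c₂, …, c_k, c₁]`. -/
def rotate (q t k : ℕ) [NeZero k] [NeZero t] : WheelGroup q t k →+ WheelGroup q t k where
  toFun C := ⟨fun i => C.1 (i + 1), isCritical_rotate C.2⟩
  map_zero' := eq_reduce (zero_equiv q t k).rotate
  map_add' C D := eq_reduce (add_equiv C D).rotate

end WheelGroup

/-- The positive integers, ordered by divisibility. -/
@[ext]
structure DvdIndex : Type where
  /-- The underlying natural number. -/
  val : ℕ
  /-- It is positive. -/
  pos : 0 < val

instance : DecidableEq DvdIndex := fun k l => decidable_of_iff (k.val = l.val) DvdIndex.ext_iff.symm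

instance (k : DvdIndex) : NeZero k.val := ⟨k.pos.ne'⟩

instance : Preorder DvdIndex where
  le k l := k.val ∣ l.val
  le_refl k := dvd_refl k.val
  le_trans _ _ _ h h' := dvd_trans h h'

/-- The direct limit of the critical groups of the wheels along periodic extension. -/
abbrev WheelLimit (q t : ℕ) [NeZero t] : Type :=
  AddCommGroup.DirectLimit (fun k : DvdIndex => WheelGroup q t k.val)
    (fun _ _ h => WheelGroup.extend q t h)

/-- The shift map on the direct limit, induced by the rotations. -/
noncomputable def wheelShift (q t : ℕ) [NeZero t] : AddMonoid.End (WheelLimit q t) :=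
  AddCommGroup.DirectLimit.map (fun k : DvdIndex => WheelGroup.rotate q t k.val)
    (fun k l h => by
      refine AddMonoidHom.ext fun C => WheelGroup.ext (funext fun i => ?_)
      change C.1 (ZMod.castHom h (ZMod k.val) (i + 1)) = C.1 (ZMod.castHom h (ZMod k.val) i + 1)
      rw [map_add, map_one])

/-- The kernel of `Cyc_d(ρ)` on the direct limit, for the `d`-th cyclotomic polynomial `Cyc_d` and
the shift map `ρ`. -/
noncomputable def cycKernel (q t d : ℕ) [NeZero t] : AddSubgroup (WheelLimit q t) :=
  AddMonoidHom.ker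
    (Polynomial.aeval (wheelShift q t) (Polynomial.cyclotomic d ℤ) : AddMonoid.End (WheelLimit q t))

/-! ### The polynomials

Polynomials in two variables: `X 0` is `q`, and `X 1` is `t` or `N₁`. -/

/-- The spanning tree polynomial `𝒲_k(q,t)` of the wheels. -/
noncomputable def wheelPoly (k : ℕ) [NeZero k] : MvPolynomial (Fin 2) ℤ :=
  treeCount (wheel (MvPolynomial.X 0) (MvPolynomial.X 1) k)

/-- The power sums `α ^ k + β ^ k`, where `α β = q` and `α + β = 1 + q - N₁`. -/
noncomputable def frobeniusTrace : ℕ → MvPolynomial (Fin 2) ℤ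
  | 0 => 2
  | 1 => 1 + MvPolynomial.X 0 - MvPolynomial.X 1
  | k + 2 => (1 + MvPolynomial.X 0 - MvPolynomial.X 1) * frobeniusTrace (k + 1)
      - MvPolynomial.X 0 * frobeniusTrace k

/-- The polynomial `N_k(q, N₁) = 1 + q ^ k - α ^ k - β ^ k` that gives the number of points over
the extension of degree `k` of an elliptic curve with `N₁` points over the field with `q`
elements. -/
noncomputable def ellipticPoly (k : ℕ) : MvPolynomial (Fin 2) ℤ :=
  1 + MvPolynomial.X 0 ^ k - frobeniusTrace k

/-- The elliptic cyclotomic polynomials, determined recursively by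
`N_d = ∏_{e ∣ d} ECyc_e`: the quotient of `N_d` by the product over the proper divisors. -/
noncomputable def ellipticCyc (d : ℕ) : MvPolynomial (Fin 2) ℤ :=
  Classical.epsilon fun P : MvPolynomial (Fin 2) ℤ =>
    P * ∏ e ∈ d.properDivisors.attach, ellipticCyc e.1 = ellipticPoly d
termination_by d
decreasing_by exact (Nat.mem_properDivisors.1 e.2).2

/-- The wheel cyclotomic polynomials: `WCyc_1 = t`, and `WCyc_d(q,t) = ECyc_d(q,-t)` for
`d ≥ 2`. -/
noncomputable def wheelCyc (d : ℕ) : MvPolynomial (Fin 2) ℤ :=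
  if d = 1 then MvPolynomial.X 1
  else MvPolynomial.aeval ![MvPolynomial.X 0, -MvPolynomial.X 1] (ellipticCyc d)

/-! ### The matrix-tree theorem -/

/-! Put `s = 1 + q + t` and `Q = X ^ 2 - s X + q`, with companion matrix `M`. Identify
configurations on `k` rim vertices with `ℤ[X] / (X ^ k - 1)`, the rotation being multiplication by
`X`. The reduced Laplacian becomes `s - q X⁻¹ - X`, which is `Q` up to the unit `-X`. Every class
modulo firings contains exactly one critical configuration, so the critical group is the finite
cyclic module `ℤ[X] / (X ^ k - 1, Q)`.

On a finite group, the kernel and cokernel of `p(ρ)` have the same order. If `p` divides `X ^ k -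
1`, the cokernel is `ℤ[X] / (Q, p)`, of order `|det p(M)|` when this is nonzero
(`WheelGroup.card_ker_aeval_rotate`). In the direct limit, an element killed by `Cyc_d(ρ)` is fixed
by `ρ ^ d`, hence comes from the wheel with `d` rim vertices (`cycKernel_eq_map`).

On the polynomial side, `N_k = det (M ^ k - 1)` with `s = 1 + q - N₁`, so factoring `X ^ k - 1`
gives `ECyc_d = det Cyc_d(M)` (`ellipticCyc_eq_frobDet`). Substituting `N₁ = -t` leads back to `s =
1 + q + t`.

For the factorization of the tree polynomial, the index of `(X ^ k - 1, Q)` is computed twice: as a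
determinant of size `k`, a tree count by `treeCount_eq_det`, and as one of size two. This settles
the identity up to sign, and one evaluation fixes the sign (`prod_wheelCyc`). Tree counts are
positive, so by induction the values of `WCyc_d` are positive, which removes the absolute values. -/

theorem IsRootedTree.exists_depth {V : Type*} {p : V → Option V} (hp : IsRootedTree p) :
    ∃ r : V → ℕ, ∀ v w, p v = some w → r w < r v := by
  classical
  refine ⟨fun v => Nat.find (hp v), fun v w h => ?_⟩
  have hv := Nat.find_spec (hp v)
  rcases hn : Nat.find (hp v) with _ | m
  · rw [hn] at hv
    simp at hv
  · rw [hn, Function.iterate_succ_apply, Option.bind_some, h] at hv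
    exact (Nat.lt_succ_of_le (Nat.find_min' (hp w) hv)).trans_eq hn.symm

section MatrixTree

variable {V R : Type*} [Fintype V] [DecidableEq V] [CommRing R]

/-- The Laplacian of a rooted directed multigraph, without the row and column of the root. -/
def reducedLaplacian (d : Option V → Option V → R) : Matrix V V R :=
  fun v w => (if v = w then ∑ u, d (some v) u else 0) - d (some v) (some w)

/-- The reduced Laplacian of the graph with a single edge from `v` to `p v`, for every `v`. -/
def functionalLaplacian (R : Type*) [CommRing R] (p : V → Option V) : Matrix V V R :=
  fun v w => (if v = w then 1 else 0) - if p v = some w then 1 else 0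

/-- Every edge strictly lowers the number of steps to the root. Grouping the vertices by this number
makes the matrix block triangular, and the diagonal blocks are identities since no edge stays within
a level. -/
theorem det_functionalLaplacian_of_isRootedTree {p : V → Option V} (hp : IsRootedTree p) :
    (functionalLaplacian R p).det = 1 := by
  obtain ⟨r, hr⟩ := hp.exists_depth
  have ht : (functionalLaplacian R p).BlockTriangular (fun v => OrderDual.toDual (r v)) := by
    intro v w h
    have h : r v < r w := h
    have h1 : v ≠ w := fun e => by simp [e] at h
    have h2 : p v ≠ some w := fun e => (hr v w e).not_gt h
    simp [functionalLaplacian, h1, h2]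
  rw [ht.det]
  refine Finset.prod_eq_one fun a _ => ?_
  suffices h : (functionalLaplacian R p).toSquareBlock (fun v => OrderDual.toDual (r v)) a = 1 by
    rw [h, Matrix.det_one]
  ext ⟨v, hv⟩ ⟨w, hw⟩
  have h2 : p v ≠ some w := fun e => by
    have h3 := hr v w e
    have h4 : OrderDual.toDual (r v) = OrderDual.toDual (r w) := hv.trans hw.symm
    rw [OrderDual.toDual_inj.1 h4] at h3
    exact h3.false
  simp [Matrix.toSquareBlock_def, functionalLaplacian, h2, Matrix.one_apply]

theorem functionalLaplacian_mulVec (p : V → Option V) (x : V → R) (v : V) :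
    (functionalLaplacian R p).mulVec x v = x v - (p v).elim 0 x := by
  simp only [Matrix.mulVec, dotProduct, functionalLaplacian, sub_mul, ite_mul, one_mul, zero_mul,
    Finset.sum_sub_distrib, Finset.sum_ite_eq, Finset.mem_univ, if_true]
  congr 1
  rcases p v with _ | u <;> simp

/-- The indicator function of the vertices from which the root is never reached is a nonzero kernel
vector: `v` is such a vertex exactly when `p v` is. -/
theorem det_functionalLaplacian_of_not_isRootedTree {p : V → Option V} (hp : ¬ IsRootedTree p) :
    (functionalLaplacian R p).det = 0 := by
  classical
  -- A kernel vector forces a zero determinant over a domain, which `R` need not be; the entries are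
  -- integers, so `ℤ` suffices.
  suffices h : (functionalLaplacian ℤ p).det = 0 by
    have h2 : functionalLaplacian R p = (Int.castRingHom R).mapMatrix (functionalLaplacian ℤ p) := by
      ext v w
      simp [functionalLaplacian]
    rw [h2, ← RingHom.map_det, h, map_zero]
  rw [← Matrix.exists_mulVec_eq_zero_iff]
  let S : Option V → Prop := fun o => ∀ n, (fun o : Option V => o.bind p)^[n] o ≠ none
  have hS : ∀ v, S (some v) ↔ S (p v) := by
    intro v
    constructor
    · intro h n
      simpa using h (n + 1)
    · rintro h (_ | n)
      · simp
      · simpa using h n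
  refine ⟨fun v => if S (some v) then 1 else 0, ?_, ?_⟩
  · obtain ⟨v, hv⟩ := not_forall.1 hp
    intro h
    have h1 := congrFun h v
    have h2 : S (some v) := fun n hn => hv ⟨n, hn⟩
    simp [h2] at h1
  · ext v
    rw [functionalLaplacian_mulVec]
    have h0 : ¬ S none := fun h => h 0 rfl
    have h1 := hS v
    rcases hpv : p v with _ | u
    · rw [hpv] at h1
      simp [h1, h0]
    · rw [hpv] at h1
      simp [h1]

/-- Each row is a sum over the edges leaving its vertex, and the determinant is multilinear in the
rows; expanding it chooses one edge per vertex. -/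
theorem det_reducedLaplacian (d : Option V → Option V → R) :
    (reducedLaplacian d).det =
      ∑ p : V → Option V, (∏ v, d (some v) (p v)) * (functionalLaplacian R p).det := by
  have h : reducedLaplacian d = fun v => ∑ u : Option V,
      d (some v) u • fun w : V => ((if v = w then 1 else 0) - if u = some w then 1 else 0 : R) := by
    ext v w
    simp only [reducedLaplacian, Finset.sum_apply, Pi.smul_apply, smul_eq_mul, mul_sub,
      Finset.sum_sub_distrib, mul_ite, mul_one, mul_zero, Finset.sum_ite_eq', Finset.mem_univ,
      if_true]
    split_ifs <;> simp
  rw [h]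
  refine (MultilinearMap.map_sum (Matrix.detRowAlternating (R := R)).toMultilinearMap _).trans ?_
  refine Finset.sum_congr rfl fun p _ => ?_
  rw [MultilinearMap.map_smul_univ, smul_eq_mul]
  rfl

/-- The matrix-tree theorem for rooted directed multigraphs. -/
theorem treeCount_eq_det (d : Option V → Option V → R) :
    treeCount d = (reducedLaplacian d).det := by
  classical
  rw [det_reducedLaplacian, treeCount, Finset.sum_filter]
  refine Finset.sum_congr (by ext; simp) fun p _ => ?_
  split_ifs with hp
  · rw [det_functionalLaplacian_of_isRootedTree hp, mul_one]
  · rw [det_functionalLaplacian_of_not_isRootedTree hp, mul_zero]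

end MatrixTree

/-! ### Specialization and positivity of tree counts -/

theorem map_treeCount {V R S : Type*} [Fintype V] [CommSemiring R] [CommSemiring S] (φ : R →+* S)
    (d : Option V → Option V → R) : φ (treeCount d) = treeCount fun v w => φ (d v w) := by
  simp only [treeCount, map_sum, map_prod]

/-- The star, in which every vertex points straight to the root, is one of the trees counted. -/
theorem prod_root_le_treeCount {V : Type*} [Fintype V] (d : Option V → Option V → ℕ) :
    ∏ v, d (some v) none ≤ treeCount d := by
  classical
  rw [treeCount]
  refine Finset.single_le_sum (f := fun p : V → Option V => ∏ v, d (some v) (p v))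
    (fun _ _ => Nat.zero_le _) (a := fun _ => none) ?_
  exact Finset.mem_filter.2 ⟨Finset.mem_univ _, fun v => ⟨1, rfl⟩⟩

theorem map_wheel {R S : Type*} [CommSemiring R] [CommSemiring S] (φ : R →+* S) (q t : R) (k : ℕ)
    (v w : Option (ZMod k)) : φ (wheel q t k v w) = wheel (φ q) (φ t) k v w := by
  rcases v with _ | v <;> rcases w with _ | w <;> simp [wheel, apply_ite φ]

theorem treeCount_wheel_pos (q t k : ℕ) [NeZero k] [NeZero t] : 0 < treeCount (wheel q t k) :=
  (Finset.prod_pos fun _ _ => Nat.pos_of_ne_zero (NeZero.ne t)).trans_le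
    (prod_root_le_treeCount (wheel q t k))

theorem eval_wheelPoly (q t k : ℕ) [NeZero k] :
    MvPolynomial.eval ![(q : ℤ), (t : ℤ)] (wheelPoly k) = (treeCount (wheel q t k) : ℕ) := by
  rw [wheelPoly, map_treeCount, ← Nat.coe_castRingHom, map_treeCount]
  simp only [map_wheel]
  simp

/-! ### Evaluation of integer polynomials at a companion matrix of size two -/

section Companion

variable {R S : Type*} [CommRing R] [CommRing S]

/-- The matrix of multiplication by `X` modulo `X ^ 2 - s X + q`. -/
def frobMatrix (s q : R) : Matrix (Fin 2) (Fin 2) R := !![0, -q; 1, s]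

/-- The determinant of an integer polynomial in `frobMatrix s q`, that is, the resultant of the
polynomial with `X ^ 2 - s X + q`. -/
noncomputable def frobDet (s q : R) : Polynomial ℤ →* R :=
  Matrix.detMonoidHom.comp (Polynomial.aeval (frobMatrix s q)).toRingHom.toMonoidHom

theorem frobDet_apply (s q : R) (p : Polynomial ℤ) :
    frobDet s q p = (Polynomial.aeval (frobMatrix s q) p).det := rfl

theorem map_frobDet (φ : R →+* S) (s q : R) (p : Polynomial ℤ) :
    φ (frobDet s q p) = frobDet (φ s) (φ q) p := by
  have h : φ.mapMatrix (frobMatrix s q) = frobMatrix (φ s) (φ q) := by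
    ext i j
    fin_cases i <;> fin_cases j <;> simp [frobMatrix]
  rw [frobDet_apply, frobDet_apply, RingHom.map_det, ← h]
  congr 1
  exact (Polynomial.aeval_algHom_apply (φ.mapMatrix (m := Fin 2)).toIntAlgHom _ p).symm

theorem frobMatrix_sq (s q : R) : frobMatrix s q ^ 2 = s • frobMatrix s q - q • 1 := by
  ext i j
  fin_cases i <;> fin_cases j <;> simp [frobMatrix, pow_two, Matrix.mul_apply] <;>
    ring

theorem trace_frobMatrix_pow (s q : R) (k : ℕ) :
    (frobMatrix s q ^ (k + 2)).trace =
      s * (frobMatrix s q ^ (k + 1)).trace - q * (frobMatrix s q ^ k).trace := by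
  rw [pow_add, frobMatrix_sq, mul_sub, Matrix.mul_smul, Matrix.mul_smul, mul_one, ← pow_succ,
    Matrix.trace_sub, Matrix.trace_smul, Matrix.trace_smul, smul_eq_mul, smul_eq_mul]

/-- A matrix `M` of size two satisfies `det (M - 1) = 1 + det M - tr M`. Applied to the `k`-th power
of the companion matrix, this is the shape of the formula for `N_k`. -/
theorem frobDet_X_pow_sub_one (s q : R) (k : ℕ) :
    frobDet s q (Polynomial.X ^ k - 1) = 1 + q ^ k - (frobMatrix s q ^ k).trace := by
  have h : (frobMatrix s q).det = q := by simp [frobMatrix, Matrix.det_fin_two]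
  have h2 (M : Matrix (Fin 2) (Fin 2) R) : (M - 1).det = 1 + M.det - M.trace := by
    simp [Matrix.det_fin_two, Matrix.trace_fin_two]
    ring
  rw [frobDet_apply, map_sub, map_pow, Polynomial.aeval_X, map_one, h2, Matrix.det_pow, h]

theorem prod_frobDet_cyclotomic (s q : R) {k : ℕ} (hk : 0 < k) :
    ∏ d ∈ k.divisors, frobDet s q (Polynomial.cyclotomic d ℤ) =
      frobDet s q (Polynomial.X ^ k - 1) := by
  rw [← map_prod, Polynomial.prod_cyclotomic_eq_X_pow_sub_one hk]

end Companion

/-! ### Elliptic and wheel cyclotomic polynomials -/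

open MvPolynomial in
theorem frobeniusTrace_eq_trace (k : ℕ) :
    frobeniusTrace k = (frobMatrix (1 + X 0 - X 1 : MvPolynomial (Fin 2) ℤ) (X 0) ^ k).trace := by
  induction k using Nat.twoStepInduction with
  | zero => simp [frobeniusTrace]
  | one => simp [frobeniusTrace, frobMatrix, Matrix.trace_fin_two]
  | more k h1 h2 => rw [frobeniusTrace, h1, h2, trace_frobMatrix_pow]

open MvPolynomial in
theorem ellipticPoly_eq_frobDet (k : ℕ) :
    ellipticPoly k = frobDet (1 + X 0 - X 1) (X 0) (Polynomial.X ^ k - 1) := by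
  rw [ellipticPoly, frobeniusTrace_eq_trace, frobDet_X_pow_sub_one]

theorem ellipticPoly_ne_zero {k : ℕ} (hk : 0 < k) : ellipticPoly k ≠ 0 := by
  intro h
  -- At `q = 0`, `N₁ = 1` one has `α = β = 0`, so `N_k` takes the value `1`.
  have h1 := congrArg (MvPolynomial.eval ![(0 : ℤ), 1]) h
  have h2 (n : ℕ) : MvPolynomial.eval ![(0 : ℤ), 1] (frobeniusTrace (n + 1)) = 0 := by
    induction n using Nat.twoStepInduction with
    | zero => simp [frobeniusTrace]
    | one => simp [frobeniusTrace]
    | more n _ _ => simp [frobeniusTrace]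
  obtain ⟨n, rfl⟩ := Nat.exists_eq_succ_of_ne_zero hk.ne'
  simp [ellipticPoly, h2] at h1

open MvPolynomial in
-- The determinant solves the defining equation because `X ^ d - 1` is the product of cyclotomic
-- polynomials. The solution is unique: the polynomial ring is a domain and `N_d ≠ 0`, so the
-- product over proper divisors can be cancelled.
theorem ellipticCyc_eq_frobDet {d : ℕ} (hd : 0 < d) :
    ellipticCyc d = frobDet (1 + X 0 - X 1) (X 0) (Polynomial.cyclotomic d ℤ) := by
  induction d using Nat.strong_induction_on with
  | _ d ih =>
    have h1 : ∏ e ∈ d.properDivisors.attach, ellipticCyc e.1 =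
        ∏ e ∈ d.properDivisors, frobDet (1 + X 0 - X 1) (X 0) (Polynomial.cyclotomic e ℤ) := by
      rw [Finset.prod_attach _ ellipticCyc]
      refine Finset.prod_congr rfl fun e he => ?_
      exact ih e (Nat.mem_properDivisors.1 he).2 (Nat.pos_of_mem_properDivisors he)
    have h2 : frobDet (1 + X 0 - X 1) (X 0) (Polynomial.cyclotomic d ℤ) *
        ∏ e ∈ d.properDivisors.attach, ellipticCyc e.1 = ellipticPoly d := by
      rw [h1, ellipticPoly_eq_frobDet, ← prod_frobDet_cyclotomic _ _ hd,
        ← Nat.cons_self_properDivisors hd.ne', Finset.prod_cons]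
    have h3 : ellipticCyc d * ∏ e ∈ d.properDivisors.attach, ellipticCyc e.1 = ellipticPoly d := by
      rw [ellipticCyc]
      exact Classical.epsilon_spec (p := fun P => P * ∏ e ∈ d.properDivisors.attach,
        ellipticCyc e.1 = ellipticPoly d) ⟨_, h2⟩
    have h4 : ∏ e ∈ d.properDivisors.attach, ellipticCyc e.1 ≠ 0 := fun h => by
      rw [h, mul_zero] at h2
      exact ellipticPoly_ne_zero hd h2.symm
    exact mul_right_cancel₀ h4 (h3.trans h2.symm)

theorem prod_ellipticCyc {k : ℕ} (hk : 0 < k) :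
    ∏ d ∈ k.divisors, ellipticCyc d = ellipticPoly k := by
  rw [ellipticPoly_eq_frobDet, ← prod_frobDet_cyclotomic _ _ hk]
  exact Finset.prod_congr rfl fun d hd => ellipticCyc_eq_frobDet (Nat.pos_of_mem_divisors hd)

open MvPolynomial in
-- The sign at `d = 1` arises because `det (M - 1) = 1 + q - s = -t`, whereas `WCyc_1 = t`.
theorem wheelCyc_eq_frobDet {d : ℕ} (hd : 0 < d) :
    wheelCyc d = (if d = 1 then -1 else 1) *
      frobDet (1 + X 0 + X 1) (X 0) (Polynomial.cyclotomic d ℤ) := by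
  rw [wheelCyc]
  split_ifs with h
  · subst h
    have h := frobDet_X_pow_sub_one (1 + X 0 + X 1) (X 0 : MvPolynomial (Fin 2) ℤ) 1
    rw [pow_one] at h
    rw [Polynomial.cyclotomic_one, h]
    simp [frobMatrix, Matrix.trace_fin_two]
  · have h2 := map_frobDet (aeval ![X 0, -X 1] : MvPolynomial (Fin 2) ℤ →ₐ[ℤ]
      MvPolynomial (Fin 2) ℤ).toRingHom (1 + X 0 - X 1) (X 0) (Polynomial.cyclotomic d ℤ)
    rw [ellipticCyc_eq_frobDet hd, one_mul]
    refine h2.trans ?_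
    simp

open MvPolynomial in
theorem prod_wheelCyc_eq_frobDet {k : ℕ} (hk : 0 < k) :
    ∏ d ∈ k.divisors, wheelCyc d =
      -frobDet (1 + X 0 + X 1) (X 0) (Polynomial.X ^ k - 1) := by
  rw [Finset.prod_congr rfl fun d hd => wheelCyc_eq_frobDet (Nat.pos_of_mem_divisors hd),
    Finset.prod_mul_distrib, prod_frobDet_cyclotomic _ _ hk, Finset.prod_ite_eq',
    if_pos (Nat.one_mem_divisors.2 hk.ne'), neg_one_mul]

/-! ### Indices of images -/

namespace AddMonoid.End

variable {G : Type*} [AddCommGroup G]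

theorem add_apply (f g : AddMonoid.End G) (x : G) : (f + g) x = f x + g x := rfl

theorem sub_apply (f g : AddMonoid.End G) (x : G) : (f - g) x = f x - g x := rfl

theorem mul_apply (f g : AddMonoid.End G) (x : G) : (f * g) x = f (g x) := rfl

theorem sum_apply {ι : Type*} (s : Finset ι) (f : ι → AddMonoid.End G) (x : G) :
    (∑ i ∈ s, f i) x = ∑ i ∈ s, f i x :=
  AddMonoidHom.finsetSum_apply f s x

end AddMonoid.End

section Index

theorem index_range_mulVecLin {n : Type*} [Fintype n] [DecidableEq n] (M : Matrix n n ℤ)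
    (h : M.det ≠ 0) : M.mulVecLin.toAddMonoidHom.range.index = M.det.natAbs := by
  have hinj : Function.Injective M.mulVecLin := by
    rw [← LinearMap.ker_eq_bot, Matrix.ker_mulVecLin_eq_bot_iff]
    intro v hv
    by_contra hv0
    exact h (Matrix.exists_mulVec_eq_zero_iff.1 ⟨v, hv0, hv⟩)
  have h1 := Submodule.natAbs_det_equiv (LinearMap.range M.mulVecLin)
    (LinearEquiv.ofInjective M.mulVecLin hinj)
  have h2 : (LinearMap.range M.mulVecLin).subtype ∘ₗ AddMonoidHom.toIntLinearMap
      (LinearEquiv.ofInjective M.mulVecLin hinj : (n → ℤ) →+ LinearMap.range M.mulVecLin) =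
      M.toLin' := by
    ext; rfl
  rw [h2, LinearMap.det_toLin'] at h1
  exact h1.symm

variable {G H : Type*} [AddCommGroup G] [AddCommGroup H]

theorem map_aeval_of_comm (φ : G →+ H) (a : AddMonoid.End G) (b : AddMonoid.End H)
    (h : ∀ x, φ (a x) = b (φ x)) (p : Polynomial ℤ) (x : G) :
    φ (Polynomial.aeval a p x) = Polynomial.aeval b p (φ x) := by
  induction p using Polynomial.induction_on' generalizing x with
  | add p r hp hr =>
    rw [map_add, map_add, AddMonoid.End.add_apply, AddMonoid.End.add_apply, map_add, hp, hr]
  | monomial n m =>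
    have hn : ∀ n x, φ ((a ^ n) x) = (b ^ n) (φ x) := by
      intro n
      induction n with
      | zero => intro x; rfl
      | succ n ih =>
        intro x
        rw [pow_succ, pow_succ, AddMonoid.End.mul_apply, AddMonoid.End.mul_apply, ih, h]
    rw [Polynomial.aeval_monomial, Polynomial.aeval_monomial, eq_intCast, eq_intCast,
      AddMonoid.End.mul_apply, AddMonoid.End.mul_apply, AddMonoid.End.intCast_apply,
      AddMonoid.End.intCast_apply, map_zsmul, hn]

/-- Evaluation of an integer polynomial at an endomorphism, and of the result at a point. -/
noncomputable def orbitMap (a : AddMonoid.End G) (v : G) : Polynomial ℤ →+ G where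
  toFun p := Polynomial.aeval a p v
  map_zero' := by rw [map_zero]; rfl
  map_add' p r := by rw [map_add]; rfl

theorem orbitMap_mul (a : AddMonoid.End G) (v : G) (p r : Polynomial ℤ) :
    orbitMap a v (p * r) = Polynomial.aeval a p (orbitMap a v r) := by
  change Polynomial.aeval a (p * r) v = _
  rw [map_mul]
  rfl

/-- The hypotheses say that `G` is the cyclic module `ℤ[X] / I` generated by `v`; the image of
multiplication by `h` is then `(I + (h)) / I`. -/
theorem orbitMap_mem_range_iff {a : AddMonoid.End G} {v : G}
    (hs : Function.Surjective (orbitMap a v)) {I : Ideal (Polynomial ℤ)}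
    (hI : ∀ p, orbitMap a v p = 0 ↔ p ∈ I) (h p : Polynomial ℤ) :
    orbitMap a v p ∈ AddMonoidHom.range (Polynomial.aeval a h : AddMonoid.End G) ↔
      p ∈ I ⊔ Ideal.span {h} := by
  rw [Submodule.mem_sup]
  constructor
  · rintro ⟨x, hx⟩
    obtain ⟨r, rfl⟩ := hs x
    refine ⟨p - h * r, (hI _).1 ?_, h * r, Ideal.mem_span_singleton.2 ⟨r, rfl⟩, by ring⟩
    rw [map_sub, orbitMap_mul, sub_eq_zero]
    exact hx.symm
  · rintro ⟨y, hy, z, hz, rfl⟩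
    obtain ⟨r, rfl⟩ := Ideal.mem_span_singleton.1 hz
    rw [map_add, (hI y).2 hy, zero_add, orbitMap_mul]
    exact ⟨_, rfl⟩

/-- Expressing the index through an ideal of `ℤ[X]` allows cokernels on different modules to be
compared. -/
theorem index_range_aeval {a : AddMonoid.End G} {v : G}
    (hs : Function.Surjective (orbitMap a v)) {I : Ideal (Polynomial ℤ)}
    (hI : ∀ p, orbitMap a v p = 0 ↔ p ∈ I) (h : Polynomial ℤ) :
    (AddMonoidHom.range (Polynomial.aeval a h : AddMonoid.End G)).index =
      (I ⊔ Ideal.span {h}).toAddSubgroup.index := by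
  rw [← AddSubgroup.index_comap_of_surjective _ hs]
  congr 1
  ext p
  exact orbitMap_mem_range_iff hs hI h p

end Index

/-! ### The companion matrix as an endomorphism -/

section Companion

open Polynomial

/-- The polynomial `X ^ 2 - s X + q`. -/
noncomputable def frobQuadratic (s q : ℤ) : ℤ[X] := X ^ 2 - C s * X + C q

theorem frobQuadratic_monic (s q : ℤ) : (frobQuadratic s q).Monic := by
  unfold frobQuadratic
  monicity!

theorem natDegree_frobQuadratic (s q : ℤ) : (frobQuadratic s q).natDegree = 2 := by
  unfold frobQuadratic
  compute_degree!

/-- The action of square integer matrices on vectors. -/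
noncomputable def mulVecEnd (n : Type*) [Fintype n] [DecidableEq n] :
    Matrix n n ℤ →+* AddMonoid.End (n → ℤ) where
  toFun M := M.mulVecLin.toAddMonoidHom
  map_one' := AddMonoidHom.ext fun x => Matrix.one_mulVec x
  map_mul' M N := AddMonoidHom.ext fun x => (Matrix.mulVec_mulVec x M N).symm
  map_zero' := AddMonoidHom.ext fun x => Matrix.zero_mulVec x
  map_add' M N := AddMonoidHom.ext fun x => Matrix.add_mulVec M N x

theorem mulVecEnd_apply {n : Type*} [Fintype n] [DecidableEq n] (M : Matrix n n ℤ) (x : n → ℤ) :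
    mulVecEnd n M x = M.mulVec x := rfl

/-- Multiplication by `frobMatrix s q`. -/
noncomputable def frobEnd (s q : ℤ) : AddMonoid.End (Fin 2 → ℤ) :=
  mulVecEnd (Fin 2) (frobMatrix s q)

theorem aeval_frobEnd (s q : ℤ) (p : ℤ[X]) :
    aeval (frobEnd s q) p = mulVecEnd (Fin 2) (aeval (frobMatrix s q) p) :=
  aeval_algHom_apply (mulVecEnd (Fin 2)).toIntAlgHom _ p

theorem orbitMap_frobEnd_linear (s q a b : ℤ) :
    orbitMap (frobEnd s q) ![1, 0] (C a + C b * X) = ![a, b] := by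
  change aeval (frobEnd s q) (C a + C b * X) ![1, 0] = _
  rw [aeval_frobEnd, mulVecEnd_apply]
  ext i
  fin_cases i <;> simp only [map_add, map_mul, aeval_C, aeval_X, Matrix.add_mulVec,
    Algebra.algebraMap_eq_smul_one, Matrix.smul_mul, one_mul, Matrix.smul_mulVec, frobMatrix] <;>
    simp

theorem orbitMap_frobEnd_surjective (s q : ℤ) :
    Function.Surjective (orbitMap (frobEnd s q) ![1, 0]) := fun x =>
  ⟨C (x 0) + C (x 1) * X, by
    rw [orbitMap_frobEnd_linear]
    ext i
    fin_cases i <;> rfl⟩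

theorem aeval_frobQuadratic (s q : ℤ) : aeval (frobMatrix s q) (frobQuadratic s q) = 0 := by
  simp only [frobQuadratic, map_add, map_sub, map_pow, map_mul, aeval_X, aeval_C, frobMatrix_sq,
    Algebra.algebraMap_eq_smul_one, Matrix.smul_mul, one_mul]
  abel

/-- Division by the monic quadratic leaves a remainder `a + b X`, whose orbit vector is `![a, b]`.
With surjectivity, this presents `ℤ ^ 2` as `ℤ[X] / (X ^ 2 - s X + q)`. -/
theorem orbitMap_frobEnd_eq_zero_iff (s q : ℤ) (p : ℤ[X]) :
    orbitMap (frobEnd s q) ![1, 0] p = 0 ↔ p ∈ Ideal.span {frobQuadratic s q} := by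
  have h0 (r : ℤ[X]) : orbitMap (frobEnd s q) ![1, 0] (frobQuadratic s q * r) = 0 := by
    rw [orbitMap_mul, aeval_frobEnd, aeval_frobQuadratic, map_zero, AddMonoid.End.zero_apply]
  rw [Ideal.mem_span_singleton]
  constructor
  · intro h
    rw [← modByMonic_eq_zero_iff_dvd (frobQuadratic_monic s q)]
    have hdeg : (p %ₘ frobQuadratic s q).natDegree ≤ 1 := by
      have := natDegree_modByMonic_lt p (frobQuadratic_monic s q) fun h => by
        have := natDegree_frobQuadratic s q
        rw [h, natDegree_one] at this
        omega
      rw [natDegree_frobQuadratic] at this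
      omega
    rw [← modByMonic_add_div p (frobQuadratic s q), map_add, h0, add_zero,
      eq_X_add_C_of_natDegree_le_one hdeg, add_comm, orbitMap_frobEnd_linear] at h
    rw [eq_X_add_C_of_natDegree_le_one hdeg]
    have h1 := congrFun h 0
    have h2 := congrFun h 1
    simp only [Matrix.cons_val_zero, Matrix.cons_val_one, Pi.zero_apply] at h1 h2
    rw [h1, h2]
    simp
  · rintro ⟨r, rfl⟩
    exact h0 r

theorem index_frobQuadratic_sup (s q : ℤ) {h : ℤ[X]} (hh : frobDet s q h ≠ 0) :
    (Ideal.span {frobQuadratic s q} ⊔ Ideal.span {h}).toAddSubgroup.index =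
      (frobDet s q h).natAbs := by
  rw [← index_range_aeval (orbitMap_frobEnd_surjective s q) (orbitMap_frobEnd_eq_zero_iff s q) h,
    aeval_frobEnd]
  exact index_range_mulVecLin (aeval (frobMatrix s q) h) hh

end Companion

/-! ### The Laplacian of the wheel as a polynomial in the shift -/

section Cyclic

open Polynomial

/-- The cyclic shift to the left. -/
def cyclicShift (k : ℕ) : AddMonoid.End (ZMod k → ℤ) where
  toFun c := fun i => c (i + 1)
  map_zero' := rfl
  map_add' _ _ := rfl

theorem cyclicShift_apply (k : ℕ) (c : ZMod k → ℤ) (i : ZMod k) :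
    cyclicShift k c i = c (i + 1) := rfl

theorem cyclicShift_pow_apply (k n : ℕ) (c : ZMod k → ℤ) (i : ZMod k) :
    (cyclicShift k ^ n) c i = c (i + n) := by
  induction n generalizing i with
  | zero => simp
  | succ n ih =>
    rw [pow_succ', AddMonoid.End.mul_apply, cyclicShift_apply, ih, Nat.cast_succ,
      add_assoc, add_comm (1 : ZMod k)]

theorem aeval_cyclicShift_apply {k n : ℕ} {p : ℤ[X]} (hp : p.natDegree < n) (c : ZMod k → ℤ)
    (i : ZMod k) : aeval (cyclicShift k) p c i = ∑ j ∈ Finset.range n, p.coeff j * c (i + j) := by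
  rw [aeval_eq_sum_range' hp, AddMonoid.End.sum_apply, Finset.sum_apply]
  refine Finset.sum_congr rfl fun j _ => ?_
  rw [Algebra.smul_def, eq_intCast, AddMonoid.End.mul_apply, AddMonoid.End.intCast_apply,
    Pi.smul_apply, cyclicShift_pow_apply, smul_eq_mul]

/-- The left shift moves the unit mass at `0` to `-1`, so `X ^ j` puts it at `-j`; hence the
reversed index. -/
theorem orbitMap_cyclicShift_of_natDegree_lt {k : ℕ} [NeZero k] {p : ℤ[X]}
    (hp : p.natDegree < k) (i : ZMod k) :
    orbitMap (cyclicShift k) (Pi.single 0 1) p i = p.coeff (-i).val := by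
  refine (aeval_cyclicShift_apply hp _ i).trans ?_
  rw [Finset.sum_eq_single_of_mem (-i).val (Finset.mem_range.2 (ZMod.val_lt _))]
  · simp
  · intro j hj hne
    have : i + j ≠ 0 := fun h => hne (by
      rw [← eq_neg_of_add_eq_zero_right h, ZMod.val_natCast_of_lt (Finset.mem_range.1 hj)])
    simp [this]

theorem orbitMap_cyclicShift_surjective (k : ℕ) [NeZero k] :
    Function.Surjective (orbitMap (cyclicShift k) (Pi.single 0 1)) := by
  classical
  intro c
  refine ⟨ofFn k fun j => c (-(j.val : ZMod k)), ?_⟩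
  ext i
  rw [orbitMap_cyclicShift_of_natDegree_lt (ofFn_natDegree_lt (NeZero.one_le) _),
    ofFn_coeff_eq_val_of_lt _ (ZMod.val_lt _)]
  simp

theorem orbitMap_cyclicShift_eq_zero_iff (k : ℕ) [NeZero k] (p : ℤ[X]) :
    orbitMap (cyclicShift k) (Pi.single 0 1) p = 0 ↔ p ∈ Ideal.span {(X ^ k - 1 : ℤ[X])} := by
  have hm : (X ^ k - 1 : ℤ[X]).Monic := monic_X_pow_sub_C 1 (NeZero.ne k)
  have hd : (X ^ k - 1 : ℤ[X]).natDegree = k := natDegree_X_pow_sub_C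
  have h0 (r : ℤ[X]) :
      orbitMap (cyclicShift k) (Pi.single 0 1) ((X ^ k - 1) * r) = 0 := by
    have : (aeval (cyclicShift k) (X ^ k - 1 : ℤ[X]) : AddMonoid.End (ZMod k → ℤ)) = 0 := by
      refine AddMonoidHom.ext fun c => funext fun i => ?_
      rw [map_sub, map_pow, aeval_X, map_one]
      change (cyclicShift k ^ k) c i - c i = 0
      rw [cyclicShift_pow_apply]
      simp
    rw [orbitMap_mul, this, AddMonoid.End.zero_apply]
  rw [Ideal.mem_span_singleton]
  constructor
  · intro h
    rw [← modByMonic_eq_zero_iff_dvd hm]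
    have hdeg : (p %ₘ (X ^ k - 1)).natDegree < k := by
      have := natDegree_modByMonic_lt p hm fun h => by
        rw [h, natDegree_one] at hd
        exact NeZero.ne k hd.symm
      rwa [hd] at this
    rw [← modByMonic_add_div p (X ^ k - 1), map_add, h0, add_zero] at h
    ext j
    rcases lt_or_ge j k with hj | hj
    · have h1 := congrFun h (-(j : ZMod k))
      rwa [orbitMap_cyclicShift_of_natDegree_lt hdeg, neg_neg, ZMod.val_natCast_of_lt hj] at h1
    · exact coeff_eq_zero_of_natDegree_lt (hdeg.trans_le hj)
  · rintro ⟨r, rfl⟩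
    exact h0 r

/-- With `X` the left shift, the Laplacian is `(1 + q + t) - q X⁻¹ - X`; multiplying it by `-X`
clears the inverse. -/
theorem aeval_frobQuadratic_cyclicShift (q t k : ℕ) (c : ZMod k → ℤ) :
    aeval (cyclicShift k) (frobQuadratic (1 + q + t) q) c =
      -wheelLap q t k (cyclicShift k c) := by
  ext i
  rw [aeval_cyclicShift_apply (n := 3) (by rw [natDegree_frobQuadratic]; norm_num)]
  simp only [frobQuadratic, Finset.sum_range_succ, wheelLap, Pi.neg_apply, AddMonoidHom.coe_mk,
    ZeroHom.coe_mk, cyclicShift_apply]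
  simp [coeff_X, coeff_one]
  rw [show i + 1 + 1 = i + 2 by ring]
  ring

theorem range_wheelLap (q t k : ℕ) :
    (wheelLap q t k).range = AddMonoidHom.range
      (aeval (cyclicShift k) (frobQuadratic (1 + q + t) q) : AddMonoid.End (ZMod k → ℤ)) := by
  ext c
  constructor
  · rintro ⟨x, rfl⟩
    refine ⟨fun i => -x (i - 1), ?_⟩
    refine (aeval_frobQuadratic_cyclicShift q t k _).trans ?_
    rw [← map_neg]
    congr 1
    ext i
    rw [Pi.neg_apply, cyclicShift_apply, add_sub_cancel_right, neg_neg]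
  · rintro ⟨x, rfl⟩
    refine ⟨-cyclicShift k x, ?_⟩
    rw [map_neg]
    exact (aeval_frobQuadratic_cyclicShift q t k x).symm

theorem orbitMap_cyclicShift_mem_range_wheelLap_iff (q t k : ℕ) [NeZero k] (p : ℤ[X]) :
    orbitMap (cyclicShift k) (Pi.single 0 1) p ∈ (wheelLap q t k).range ↔
      p ∈ Ideal.span {(X ^ k - 1 : ℤ[X])} ⊔ Ideal.span {frobQuadratic (1 + q + t) q} := by
  rw [range_wheelLap]
  exact orbitMap_mem_range_iff (orbitMap_cyclicShift_surjective k)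
    (orbitMap_cyclicShift_eq_zero_iff k) _ p

/-- The transpose appears because rows of the reduced Laplacian list edges leaving a vertex, while
the change of chips at a vertex also collects what its neighbours send. -/
theorem wheelLap_eq_mulVecLin (q t k : ℕ) [NeZero k] :
    wheelLap q t k =
      (reducedLaplacian (wheel (q : ℤ) (t : ℤ) k)).transpose.mulVecLin.toAddMonoidHom := by
  refine AddMonoidHom.ext fun x => funext fun i => ?_
  have hs (j : ZMod k) : ∑ u, wheel (q : ℤ) (t : ℤ) k (some j) u = 1 + q + t := by
    simp [wheel, Fintype.sum_option, Finset.sum_add_distrib]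
    ring
  have h1 (j : ZMod k) : i = j + 1 ↔ j = i - 1 := by rw [eq_sub_iff_add_eq, eq_comm]
  have h2 (j : ZMod k) : i = j - 1 ↔ j = i + 1 := by rw [eq_sub_iff_add_eq, eq_comm]
  simp only [LinearMap.toAddMonoidHom_coe, Matrix.mulVecLin_apply, Matrix.mulVec, dotProduct,
    Matrix.transpose_apply, reducedLaplacian, hs]
  simp [wheel, wheelLap, sub_mul, add_mul, Finset.sum_sub_distrib, Finset.sum_add_distrib, h1, h2,
    sub_sub]

theorem index_range_wheelLap (q t k : ℕ) [NeZero k] [NeZero t] :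
    (wheelLap q t k).range.index = treeCount (wheel q t k) := by
  have h : (reducedLaplacian (wheel (q : ℤ) (t : ℤ) k)).det = (treeCount (wheel q t k) : ℕ) := by
    rw [← treeCount_eq_det, ← Nat.coe_castRingHom, map_treeCount]
    simp only [map_wheel, Nat.coe_castRingHom]
  have h0 : (reducedLaplacian (wheel (q : ℤ) (t : ℤ) k)).transpose.det ≠ 0 := by
    rw [Matrix.det_transpose, h]
    exact_mod_cast (treeCount_wheel_pos q t k).ne'
  rw [wheelLap_eq_mulVecLin, index_range_mulVecLin _ h0, Matrix.det_transpose, h,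
    Int.natAbs_natCast]

/-- Both numbers are the index of `(X ^ k - 1, Q)` in `ℤ[X]`: the left one from `X ^ k - 1` acting
on `ℤ[X] / (Q)`, the right one from `Q` acting on `ℤ[X] / (X ^ k - 1)`. -/
theorem natAbs_frobDet_X_pow_sub_one (q t k : ℕ) [NeZero k] [NeZero t]
    (h : frobDet (1 + q + t : ℤ) q (X ^ k - 1) ≠ 0) :
    (frobDet (1 + q + t : ℤ) q (X ^ k - 1)).natAbs = treeCount (wheel q t k) := by
  rw [← index_range_wheelLap, ← index_frobQuadratic_sup _ _ h, range_wheelLap,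
    index_range_aeval (orbitMap_cyclicShift_surjective k) (orbitMap_cyclicShift_eq_zero_iff k),
    sup_comm]

end Cyclic

theorem prod_wheelCyc {k : ℕ} [NeZero k] : ∏ d ∈ k.divisors, wheelCyc d = wheelPoly k := by
  have hev (q t : ℕ) : MvPolynomial.eval ![(q : ℤ), (t : ℤ)] (∏ d ∈ k.divisors, wheelCyc d) =
      -frobDet (1 + q + t : ℤ) q (Polynomial.X ^ k - 1) := by
    rw [prod_wheelCyc_eq_frobDet (NeZero.pos k), map_neg, map_frobDet]
    simp
  -- At `q = 0`, `t = 1` the eigenvalues are `0` and `2`, so the value is `2 ^ k - 1`. This shows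
  -- that the product is nonzero and later decides the sign.
  have h01 : 0 < MvPolynomial.eval ![((0 : ℕ) : ℤ), ((1 : ℕ) : ℤ)]
      (∏ d ∈ k.divisors, wheelCyc d) := by
    rw [hev, frobDet_X_pow_sub_one]
    have htr (n : ℕ) : (frobMatrix (1 + (0 : ℕ) + (1 : ℕ) : ℤ) (0 : ℕ) ^ (n + 1)).trace =
        2 ^ (n + 1) := by
      induction n with
      | zero => simp [frobMatrix, Matrix.trace_fin_two]
      | succ n ih =>
        rw [trace_frobMatrix_pow, ih]
        push_cast
        ring
    obtain ⟨n, hn⟩ := Nat.exists_eq_succ_of_ne_zero (NeZero.ne k)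
    subst hn
    rw [htr]
    have : (1 : ℤ) < 2 ^ (n + 1) := one_lt_pow₀ (by norm_num) (by omega)
    simp [this]
  have hne : ∏ d ∈ k.divisors, wheelCyc d ≠ 0 := fun h => by
    rw [h, map_zero] at h01
    exact h01.false
  have hsq : (∏ d ∈ k.divisors, wheelCyc d) ^ 2 = wheelPoly k ^ 2 := by
    -- The extra factor makes the identity trivial at points where the determinant vanishes and the
    -- index comparison does not apply.
    refine mul_left_cancel₀ hne ?_
    -- Positive integer points suffice to identify polynomials, and they keep `t ≠ 0`.
    refine MvPolynomial.funext_set (fun _ => Set.range fun n : ℕ => (n + 1 : ℤ)) ?_ ?_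
    · exact fun _ => Set.infinite_range_of_injective fun m n h => by simpa using h
    · intro x hx
      obtain ⟨q, hq⟩ := hx 0 trivial
      obtain ⟨t, ht⟩ := hx 1 trivial
      have hxe : x = ![((q + 1 : ℕ) : ℤ), ((t + 1 : ℕ) : ℤ)] := by
        ext i
        fin_cases i
        · simp [← hq]
        · simp [← ht]
      rw [hxe, map_mul, map_mul, map_pow, map_pow, eval_wheelPoly, hev]
      by_cases h0 : frobDet (1 + (q + 1 : ℕ) + (t + 1 : ℕ) : ℤ) (q + 1 : ℕ) (Polynomial.X ^ k - 1) = 0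
      · rw [h0]; simp
      · rw [← natAbs_frobDet_X_pow_sub_one _ _ _ h0, Int.natCast_natAbs, sq_abs, neg_sq]
  rcases sq_eq_sq_iff_eq_or_eq_neg.1 hsq with h | h
  · exact h
  · rw [h, map_neg, eval_wheelPoly] at h01
    have := treeCount_wheel_pos 0 1 k
    omega

/-! ### The critical group as the cokernel of the Laplacian -/

theorem card_ker_eq_index_range {G : Type*} [AddCommGroup G] [Finite G] (f : G →+ G) :
    Nat.card f.ker = f.range.index := by
  have h1 := f.ker.card_mul_index
  rw [AddSubgroup.index_ker, ← f.range.card_mul_index, mul_comm] at h1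
  exact Nat.eq_of_mul_eq_mul_left Nat.card_pos h1

namespace WheelGroup

variable {q t k : ℕ}

theorem wheelEquiv_iff_mk_eq {c c' : ZMod k → ℕ} :
    WheelEquiv (q := q) (t := t) c c' ↔
      (QuotientAddGroup.mk fun i => (c i : ℤ)) =
        (QuotientAddGroup.mk fun i => (c' i : ℤ) : (ZMod k → ℤ) ⧸ (wheelLap q t k).range) := by
  rw [QuotientAddGroup.eq_iff_sub_mem]
  constructor
  · rintro ⟨x, hx⟩
    exact ⟨x, funext fun i => by rw [Pi.sub_apply, hx]; ring⟩
  · rintro ⟨x, hx⟩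
    exact ⟨x, fun i => by rw [hx, Pi.sub_apply]; ring⟩

variable [NeZero k] [NeZero t]

/-- The class of a critical configuration modulo firings. -/
noncomputable def toCokernel (q t k : ℕ) [NeZero k] [NeZero t] :
    WheelGroup q t k →+ (ZMod k → ℤ) ⧸ (wheelLap q t k).range :=
  AddMonoidHom.mk' (fun C => QuotientAddGroup.mk fun i => (C.config i : ℤ)) fun C D => by
    refine (wheelEquiv_iff_mk_eq.1 (add_equiv C D)).trans ?_
    rw [← QuotientAddGroup.mk_add]
    exact congrArg _ (funext fun i => Nat.cast_add _ _)

theorem toCokernel_apply (C : WheelGroup q t k) :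
    toCokernel q t k C = QuotientAddGroup.mk fun i => (C.config i : ℤ) := rfl

theorem toCokernel_injective : Function.Injective (toCokernel q t k) := fun _ _ h =>
  ext_equiv (wheelEquiv_iff_mk_eq.2 h)

/-- Adding `t * ∑ j, |c j|` to every entry is the Laplacian of a constant, and it makes the
configuration nonnegative, hence reducible to a critical one. -/
theorem toCokernel_surjective : Function.Surjective (toCokernel q t k) := by
  intro z
  obtain ⟨c, rfl⟩ := QuotientAddGroup.mk_surjective z
  have h0 (i : ZMod k) : 0 ≤ c i + t * ∑ j, |c j| := by
    have h1 := Finset.single_le_sum (f := fun j => |c j|) (fun j _ => abs_nonneg _)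
      (Finset.mem_univ i)
    have h2 : (1 : ℤ) ≤ t := by exact_mod_cast NeZero.one_le
    have h3 := neg_abs_le (c i)
    have h4 := le_mul_of_one_le_left ((abs_nonneg (c i)).trans h1) h2
    linarith
  refine ⟨reduce q t k fun i => (c i + t * ∑ j, |c j|).toNat, ?_⟩
  refine (wheelEquiv_iff_mk_eq.1 (reduce_equiv _)).symm.trans ?_
  rw [QuotientAddGroup.eq_iff_sub_mem]
  refine ⟨fun _ => ∑ j, |c j|, funext fun i => ?_⟩
  rw [wheelLap_const, Pi.sub_apply, Int.toNat_of_nonneg (h0 i), add_sub_cancel_left]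

instance : Finite (WheelGroup q t k) := by
  have h := index_range_wheelLap q t k
  have : Finite ((ZMod k → ℤ) ⧸ (wheelLap q t k).range) :=
    Nat.finite_of_card_ne_zero (h.trans_ne (treeCount_wheel_pos q t k).ne')
  exact Finite.of_injective _ toCokernel_injective

/-- The critical configuration in the class of an integral configuration modulo firings. -/
noncomputable def ofConfig (q t k : ℕ) [NeZero k] [NeZero t] : (ZMod k → ℤ) →+ WheelGroup q t k :=
  (AddEquiv.ofBijective (toCokernel q t k)
    ⟨toCokernel_injective, toCokernel_surjective⟩).symm.toAddMonoidHom.comp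
      (QuotientAddGroup.mk' _)

theorem toCokernel_ofConfig (c : ZMod k → ℤ) :
    toCokernel q t k (ofConfig q t k c) = QuotientAddGroup.mk c :=
  AddEquiv.apply_symm_apply (AddEquiv.ofBijective (toCokernel q t k)
    ⟨toCokernel_injective, toCokernel_surjective⟩) _

theorem ofConfig_surjective : Function.Surjective (ofConfig q t k) := fun C => by
  refine ⟨fun i => C.config i, toCokernel_injective ?_⟩
  rw [toCokernel_ofConfig, toCokernel_apply]

theorem ofConfig_eq_zero_iff (c : ZMod k → ℤ) :
    ofConfig q t k c = 0 ↔ c ∈ (wheelLap q t k).range := by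
  rw [← toCokernel_injective.eq_iff, toCokernel_ofConfig, map_zero, QuotientAddGroup.eq_zero_iff]

/-- Rotation as an element of the endomorphism ring. -/
noncomputable def rotateEnd (q t k : ℕ) [NeZero k] [NeZero t] :
    AddMonoid.End (WheelGroup q t k) :=
  rotate q t k

theorem ofConfig_cyclicShift (c : ZMod k → ℤ) :
    ofConfig q t k (cyclicShift k c) = rotateEnd q t k (ofConfig q t k c) := by
  have h := toCokernel_ofConfig (q := q) (t := t) c
  rw [toCokernel_apply, QuotientAddGroup.eq_iff_sub_mem] at h
  obtain ⟨x, hx⟩ := h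
  refine toCokernel_injective ?_
  rw [toCokernel_ofConfig, toCokernel_apply, eq_comm, QuotientAddGroup.eq_iff_sub_mem]
  refine ⟨fun i => x (i + 1), funext fun i => ?_⟩
  rw [wheelLap_rotate, hx]
  rfl

open Polynomial in
-- The class of the unit mass at `0` generates the critical group over `ℤ[X]`, with annihilator `(X
-- ^ k - 1, Q)`. The kernel has the order of the cokernel, and `X ^ k - 1` is redundant in `(X ^ k -
-- 1, Q, p)`.
theorem card_ker_aeval_rotate (q t k : ℕ) [NeZero k] [NeZero t] {p : ℤ[X]} (hp : p ∣ X ^ k - 1)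
    (h0 : frobDet (1 + q + t : ℤ) q p ≠ 0) :
    Nat.card (AddMonoidHom.ker
      (aeval (rotateEnd q t k) p :
        AddMonoid.End (WheelGroup q t k))) = (frobDet (1 + q + t : ℤ) q p).natAbs := by
  have hv (r : ℤ[X]) : orbitMap (rotateEnd q t k)
      (ofConfig q t k (Pi.single 0 1)) r =
        ofConfig q t k (orbitMap (cyclicShift k) (Pi.single 0 1) r) :=
    (map_aeval_of_comm (ofConfig q t k) (cyclicShift k)
      (rotateEnd q t k) ofConfig_cyclicShift r _).symm
  have hs : Function.Surjective (orbitMap (rotateEnd q t k)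
      (ofConfig q t k (Pi.single 0 1))) := fun C => by
    obtain ⟨c, rfl⟩ := ofConfig_surjective C
    obtain ⟨r, rfl⟩ := orbitMap_cyclicShift_surjective k c
    exact ⟨r, hv r⟩
  refine (card_ker_eq_index_range _).trans ?_
  rw [index_range_aeval hs fun r => by
      rw [hv, ofConfig_eq_zero_iff, orbitMap_cyclicShift_mem_range_wheelLap_iff],
    ← index_frobQuadratic_sup _ _ h0, sup_comm (Ideal.span {_}) (Ideal.span {_}), sup_assoc,
    sup_eq_right.2 (Ideal.span_singleton_le_span_singleton.2 hp)]

end WheelGroup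

/-! ### The direct limit -/

instance : Nonempty DvdIndex := ⟨⟨1, one_pos⟩⟩

instance : IsDirectedOrder DvdIndex where
  directed k l := ⟨⟨k.val * l.val, mul_pos k.pos l.pos⟩, dvd_mul_right _ _, dvd_mul_left _ _⟩

instance (q t : ℕ) [NeZero t] : DirectedSystem (fun k : DvdIndex => WheelGroup q t k.val)
    fun _ _ h => WheelGroup.extend q t h where
  map_self k C := by
    refine WheelGroup.ext (funext fun i => ?_)
    change C.config (ZMod.castHom _ (ZMod k.val) i) = C.config i
    congr 1
    simp
  map_map l m k hkl hlm C := by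
    refine WheelGroup.ext (funext fun i => ?_)
    change C.config (ZMod.castHom hkl _ (ZMod.castHom hlm _ i)) = C.config (ZMod.castHom _ _ i)
    congr 1
    exact RingHom.congr_fun (ZMod.castHom_comp hkl hlm) i

section Limit

variable {q t : ℕ} [NeZero t]

theorem WheelGroup.extend_injective {k l : ℕ} [NeZero k] [NeZero l] (h : k ∣ l) :
    Function.Injective (WheelGroup.extend q t h) := fun C D hCD => by
  refine WheelGroup.ext (funext fun i => ?_)
  obtain ⟨j, rfl⟩ := ZMod.castHom_surjective h i
  exact congrFun (congrArg WheelGroup.config hCD) j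

/-- The inclusion of a critical group into the direct limit. -/
noncomputable def wheelInclusion (q t : ℕ) [NeZero t] (k : DvdIndex) :
    WheelGroup q t k.val →+ WheelLimit q t :=
  AddCommGroup.DirectLimit.of (fun k : DvdIndex => WheelGroup q t k.val)
    (fun _ _ h => WheelGroup.extend q t h) k

/-- An element that vanishes in the limit vanishes at a finite stage, and periodic extension is
injective. -/
theorem wheelInclusion_injective (k : DvdIndex) : Function.Injective (wheelInclusion q t k) := by
  rw [injective_iff_map_eq_zero]
  intro C hC
  obtain ⟨l, hl, h⟩ := AddCommGroup.DirectLimit.of.zero_exact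
    (G := fun k : DvdIndex => WheelGroup q t k.val)
    (f := fun _ _ h => WheelGroup.extend q t h) k C hC
  exact WheelGroup.extend_injective hl (h.trans (map_zero _).symm)

theorem wheelInclusion_rotate (k : DvdIndex) (C : WheelGroup q t k.val) :
    wheelInclusion q t k (WheelGroup.rotateEnd q t k.val C) =
      wheelShift q t (wheelInclusion q t k C) :=
  (AddCommGroup.DirectLimit.map_apply_of
    (G := fun k : DvdIndex => WheelGroup q t k.val)
    (G' := fun k : DvdIndex => WheelGroup q t k.val)
    (f := fun _ _ h => WheelGroup.extend q t h) (f' := fun _ _ h => WheelGroup.extend q t h)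
    (fun k : DvdIndex => WheelGroup.rotate q t k.val) _ C).symm

theorem wheelInclusion_extend {k l : DvdIndex} (h : k ≤ l) (C : WheelGroup q t k.val) :
    wheelInclusion q t l (WheelGroup.extend q t h C) = wheelInclusion q t k C :=
  AddCommGroup.DirectLimit.of_f (G := fun k : DvdIndex => WheelGroup q t k.val)
    (f := fun _ _ h => WheelGroup.extend q t h) h C

theorem exists_wheelInclusion_eq (k : DvdIndex) (z : WheelLimit q t) :
    ∃ l, k ≤ l ∧ ∃ C, wheelInclusion q t l C = z := by
  induction z using AddCommGroup.DirectLimit.induction_on with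
  | ih m C =>
    obtain ⟨l, hk, hm⟩ := exists_ge_ge k m
    exact ⟨l, hk, _, wheelInclusion_extend hm C⟩

theorem WheelGroup.rotate_pow_config {k : ℕ} [NeZero k] (n : ℕ) (C : WheelGroup q t k)
    (i : ZMod k) :
    (((WheelGroup.rotateEnd q t k) ^ n) C).config i =
      C.config (i + n) := by
  induction n generalizing i with
  | zero => rw [pow_zero, AddMonoid.End.one_apply, Nat.cast_zero, add_zero]
  | succ n ih =>
    rw [pow_succ', AddMonoid.End.mul_apply]
    refine (ih (i + 1)).trans ?_
    rw [Nat.cast_succ, add_assoc, add_comm (1 : ZMod k)]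

/-- A critical configuration of period `k` is a periodic extension of a critical configuration. -/
theorem WheelGroup.exists_extend_eq {k l : ℕ} [NeZero k] [NeZero l] (h : k ∣ l)
    {C : WheelGroup q t l} (hC : ∀ i, C.config (i + k) = C.config i) :
    ∃ D, WheelGroup.extend q t h D = C := by
  have hper (a : ZMod l) (n : ℕ) : C.config (a + n * k) = C.config a := by
    induction n with
    | zero => simp
    | succ n ih => rw [Nat.cast_succ, add_one_mul, ← add_assoc, hC, ih]
  -- One period of `C` is not known to be critical, so it is reduced first. The extension of the
  -- result is critical and equivalent to `C`, hence equal to it.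
  refine ⟨WheelGroup.reduce q t k fun j => C.config j.val, WheelGroup.ext_equiv ?_⟩
  refine ((WheelGroup.reduce_equiv _).comp_cast h).symm.trans ?_
  have hc : (fun j : ZMod k => C.config j.val) ∘ ZMod.castHom h (ZMod k) = C.config := by
    ext i
    have hi : (ZMod.castHom h (ZMod k) i).val = i.val % k := by
      rw [← ZMod.val_natCast, ← map_natCast (ZMod.castHom h (ZMod k)), ZMod.natCast_zmod_val]
    rw [Function.comp_apply, hi, ← hper _ (i.val / k)]
    congr 1
    rw [← Nat.cast_mul, ← Nat.cast_add, mul_comm, Nat.mod_add_div, ZMod.natCast_zmod_val]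
  rw [hc]
  exact .refl _

/-- A representative can be chosen at a level divisible by `k`; there, by injectivity, rotation by
`k` fixes it, so it is a word of period `k`. -/
theorem exists_wheelInclusion_eq_of_shift {k : DvdIndex} {z : WheelLimit q t}
    (hz : (wheelShift q t ^ k.val) z = z) : ∃ C, wheelInclusion q t k C = z := by
  obtain ⟨l, hl, C, rfl⟩ := exists_wheelInclusion_eq k z
  have hC : ((WheelGroup.rotateEnd q t l.val) ^ k.val) C = C := by
    refine wheelInclusion_injective l (Eq.trans ?_ hz)
    have h := map_aeval_of_comm (wheelInclusion q t l)
      (WheelGroup.rotateEnd q t l.val) (wheelShift q t)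
      (wheelInclusion_rotate l) (Polynomial.X ^ k.val) C
    rwa [map_pow, map_pow, Polynomial.aeval_X, Polynomial.aeval_X] at h
  obtain ⟨D, rfl⟩ := WheelGroup.exists_extend_eq (C := C) hl fun i => by
    rw [← WheelGroup.rotate_pow_config, hC]
  exact ⟨D, (wheelInclusion_extend hl D).symm⟩

open Polynomial in
-- Since `Cyc_d` divides `X ^ d - 1`, the kernel lies in the part fixed by `ρ ^ d`, and so already
-- in the critical group at level `d`.
theorem cycKernel_eq_map (q t : ℕ) [NeZero t] (d : DvdIndex) :
    cycKernel q t d.val = (AddMonoidHom.ker (aeval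
      (WheelGroup.rotateEnd q t d.val) (cyclotomic d.val ℤ) :
        AddMonoid.End (WheelGroup q t d.val))).map (wheelInclusion q t d) := by
  have hcomm := map_aeval_of_comm (wheelInclusion q t d)
      (WheelGroup.rotateEnd q t d.val) (wheelShift q t)
      (wheelInclusion_rotate d) (cyclotomic d.val ℤ)
  ext z
  constructor
  · intro hz
    replace hz : aeval (wheelShift q t) (cyclotomic d.val ℤ) z = 0 := hz
    obtain ⟨r, hr⟩ := cyclotomic.dvd_X_pow_sub_one d.val ℤ
    have h1 : aeval (wheelShift q t) (X ^ d.val - 1 : ℤ[X]) z = 0 := by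
      rw [hr, mul_comm, map_mul, AddMonoid.End.mul_apply, hz, map_zero]
    rw [map_sub, map_pow, aeval_X, map_one, AddMonoid.End.sub_apply, AddMonoid.End.one_apply,
      sub_eq_zero] at h1
    obtain ⟨C, rfl⟩ := exists_wheelInclusion_eq_of_shift h1
    refine ⟨C, wheelInclusion_injective d ?_, rfl⟩
    rw [map_zero]
    exact (hcomm C).trans hz
  · rintro ⟨C, hC, rfl⟩
    refine (hcomm C).symm.trans ?_
    rw [show aeval (WheelGroup.rotateEnd q t d.val)
      (cyclotomic d.val ℤ) C = 0 from hC, map_zero]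

end Limit

/-- The product over all divisors is a positive tree count, and the factors at proper divisors are
positive by induction. This also supplies the nonvanishing that the index computations require. -/
theorem eval_wheelCyc_pos (q t : ℕ) [NeZero t] {d : ℕ} (hd : 0 < d) :
    0 < MvPolynomial.eval ![(q : ℤ), (t : ℤ)] (wheelCyc d) := by
  induction d using Nat.strong_induction_on with
  | _ d ih =>
    have : NeZero d := ⟨hd.ne'⟩
    have h := congrArg (MvPolynomial.eval ![(q : ℤ), (t : ℤ)]) (prod_wheelCyc (k := d))
    rw [eval_wheelPoly, ← Nat.cons_self_properDivisors hd.ne', Finset.prod_cons, map_mul,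
      map_prod] at h
    have h1 : (0 : ℤ) < (treeCount (wheel q t d) : ℕ) := by
      exact_mod_cast treeCount_wheel_pos q t d
    rw [← h] at h1
    refine pos_of_mul_pos_left h1 (Finset.prod_nonneg fun e he => ?_)
    exact (ih e (Nat.mem_properDivisors.1 he).2 (Nat.pos_of_mem_properDivisors he)).le

theorem eval_wheelCyc_eq_natAbs (q t : ℕ) [NeZero t] {d : ℕ} (hd : 0 < d) :
    MvPolynomial.eval ![(q : ℤ), (t : ℤ)] (wheelCyc d) =
      (frobDet (1 + q + t : ℤ) q (Polynomial.cyclotomic d ℤ)).natAbs := by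
  have h := eval_wheelCyc_pos q t hd
  rw [← abs_of_pos h, wheelCyc_eq_frobDet hd, map_mul, map_frobDet, abs_mul]
  split_ifs <;> simp

theorem theorem8 :
    (∀ (k : ℕ) [NeZero k], ∏ d ∈ k.divisors, ellipticCyc d = ellipticPoly k) ∧
    (∀ (k : ℕ) [NeZero k], ∏ d ∈ k.divisors, wheelCyc d = wheelPoly k) ∧
    ∀ (q t d : ℕ) [NeZero t] [NeZero d],
      Finite (cycKernel q t d) ∧
      (Nat.card (cycKernel q t d) : ℤ) =
        MvPolynomial.eval ![(q : ℤ), (t : ℤ)] (wheelCyc d) := by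
  refine ⟨fun k _ => prod_ellipticCyc (NeZero.pos k), fun k _ => prod_wheelCyc,
    fun q t d _ _ => ?_⟩
  have hd := NeZero.pos d
  have hpos := eval_wheelCyc_pos q t hd
  have hcard : (Nat.card (cycKernel q t d) : ℤ) =
      MvPolynomial.eval ![(q : ℤ), (t : ℤ)] (wheelCyc d) := by
    rw [eval_wheelCyc_eq_natAbs q t hd] at hpos ⊢
    rw [cycKernel_eq_map q t ⟨d, hd⟩, ← Nat.card_congr (AddSubgroup.equivMapOfInjective _ _
      (wheelInclusion_injective _)).toEquiv]
    refine congrArg Nat.cast (WheelGroup.card_ker_aeval_rotate q t d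
      (Polynomial.cyclotomic.dvd_X_pow_sub_one d ℤ) fun h => ?_)
    simp [h] at hpos
  -- `Nat.card` of an infinite type is `0`, so a positive cardinality yields finiteness.
  refine ⟨Nat.finite_of_card_ne_zero fun h => ?_, hcard⟩
  rw [← hcard, h] at hpos
  exact hpos.false
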